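/- Let $d\ge 2$, let $\mathbb{S}^d\subset\mathbb{R}^{d+1}$ be the unit sphere with normalized surface measure $\sigma_d$, and let $s>d/2$. For $\ell\ge 0$ let $\{Y_{\ell,k}: k=1,\dots,Z(d,\ell)\}$ be an $L_2(\sigma_d)$-orthonormal basis of the space of real spherical harmonics of exact degree $\ell$, put $\lambda_\ell=\ell(\ell+d-1)$ and $\widehat f_{\ell,k}=\int_{\mathbb{S}^d} f\,Y_{\ell,k}\,d\sigma_d$. The Sobolev space $\mathbb{H}^s(\mathbb{S}^d)$ consists of all real-valued $f\in L_2(\sigma_d)$ with $\sum_{\ell}\sum_k (1+\lambda_\ell)^s|\widehat f_{\ell,k}|^2<\infty$ (each such $f$ is identified with its continuous representative). Fix positive real numbers $(a_\ell)_{\ell\ge0}$ with $c_1(1+\lambda_\ell)^{-s}\le a_\ell\le c_2(1+\lambda_\ell)^{-s}$ for all $\ell$ and some constants $c_1,c_2>0$, and equip $\mathbb{H}^s(\mathbb{S}^d)$ with the norm $\|f\|_{\mathbb{H}^s}=\big(\sum_\ell\sum_k a_\ell^{-1}|\widehat f_{\ell,k}|^2\big)^{1/2}$. For $x_1,\dots,x_N\in\mathbb{S}^d$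 define the worst-case error $$\mathrm{wce}(x_1,\dots,x_N)=\sup_{f\in\mathbb{H}^s(\mathbb{S}^d),\ \|f\|_{\mathbb{H}^s}\le1}\Big|\frac1N\sum_{j=1}^N f(x_j)-\int_{\mathbb{S}^d} f\,d\sigma_d\Big| .$$ (i) There is a constant $b>0$, depending only on $d$, $s$ and the choice of the norm (that is, of $(a_\ell)$), such that for every $N\ge1$ and all independent random points $x_1,\dots,x_N$ uniformly distributed on $\mathbb{S}^d$, $$\sqrt{\mathbb{E}\big[\mathrm{wce}(x_1,\dots,x_N)^2\big]}=\frac{b}{N^{1/2}} .$$ (ii) Random points do not form QMC designs: let $I\subset\mathbb{N}$ be infinite and, for each $N\in I$, let $X_N$ consist of $N$ independent uniformly distributed random points on $\mathbb{S}^d$, all on one probability space, with any joint distribution of the different $X_N$. Then almost surely $(X_N)_{N\in I}$ is not a sequence of QMC designs for $\mathbb{H}^s(\mathbb{S}^d)$; that is, almost surely there is no constant $c>0$ with $\mathrm{wce}(X_N)\le c\,N^{-s/d}$ for all $N\in I$ with $N\ge1$. -/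

import Mathlib

open MeasureTheory ProbabilityTheory
open scoped ENNReal

universe u

/-- The unit sphere `S^d` in the Euclidean space `ℝ^(d+1)`. -/
abbrev USphere (d : ℕ) : Type :=
  Metric.sphere (0 : EuclideanSpace ℝ (Fin (d + 1))) 1

/-- The normalized surface measure `σ_d` on `S^d`. -/
noncomputable def sphereMeasure (d : ℕ) : Measure (USphere d) :=
  ((volume : Measure (EuclideanSpace ℝ (Fin (d + 1)))).toSphere Set.univ)⁻¹ •
    (volume : Measure (EuclideanSpace ℝ (Fin (d + 1)))).toSphere

/-- The spherical harmonics of exact degree `ℓ` on `S^d`: restrictions to the sphere of the real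
homogeneous harmonic polynomials of degree `ℓ` in `d + 1` variables. -/
noncomputable def sphericalHarmonics (d ℓ : ℕ) : Submodule ℝ C(USphere d, ℝ) where
  carrier := {Y | ∃ p : MvPolynomial (Fin (d + 1)) ℝ, p.IsHomogeneous ℓ ∧
    ∑ i, MvPolynomial.pderiv i (MvPolynomial.pderiv i p) = 0 ∧
    ∀ x : USphere d, Y x = MvPolynomial.eval (fun i => x.1 i) p}
  add_mem' := by
    rintro f g ⟨p, hp, hp0, hpf⟩ ⟨q, hq, hq0, hqg⟩
    refine ⟨p + q, hp.add hq, ?_, fun x => by simp [hpf, hqg]⟩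
    simp [Finset.sum_add_distrib, hp0, hq0]
  zero_mem' := ⟨0, MvPolynomial.isHomogeneous_zero _ _ _, by simp, fun x => by simp⟩
  smul_mem' := by
    rintro c f ⟨p, hp, hp0, hpf⟩
    refine ⟨c • p, (MvPolynomial.homogeneousSubmodule _ _ _).smul_mem c hp, ?_, fun x => by
      simp [hpf, MvPolynomial.smul_eval]⟩
    simp [← Finset.smul_sum, hp0]

/-- `Z(d,ℓ)`, the dimension of the space of spherical harmonics of degree `ℓ` on `S^d`. -/
noncomputable def harmonicDim (d ℓ : ℕ) : ℕ := Module.finrank ℝ (sphericalHarmonics d ℓ)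

/-- `(Y ℓ k)`, `k < Z(d,ℓ)`, is for every `ℓ` an `L²(σ_d)`-orthonormal basis of the space of
spherical harmonics of degree `ℓ`. -/
structure IsHarmonicBasis (d : ℕ) (Y : (ℓ : ℕ) → Fin (harmonicDim d ℓ) → C(USphere d, ℝ)) :
    Prop where
  orthonormal : ∀ ℓ j k, ∫ x, Y ℓ j x * Y ℓ k x ∂(sphereMeasure d) = if j = k then 1 else 0
  span_eq : ∀ ℓ, Submodule.span ℝ (Set.range (Y ℓ)) = sphericalHarmonics d ℓ

/-- The eigenvalue `λ_ℓ = ℓ (ℓ + d - 1)` of the negative Laplace-Beltrami operator on `S^d`. -/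
def sphereEigenvalue (d ℓ : ℕ) : ℝ := (ℓ : ℝ) * ((ℓ : ℝ) + (d : ℝ) - 1)

/-- The Laplace-Fourier coefficient `∫ f Y dσ_d`. -/
noncomputable def lfCoeff {d : ℕ} (f Y : C(USphere d, ℝ)) : ℝ :=
  ∫ x, f x * Y x ∂(sphereMeasure d)

/-- `f ∈ H^s(S^d)`, for continuous `f`. For `s > d/2` every element of the Sobolev space, as a
class in `L²`, has a unique continuous representative, and point values refer to it. -/
def MemSobolev {d : ℕ} (s : ℝ) (Y : (ℓ : ℕ) → Fin (harmonicDim d ℓ) → C(USphere d, ℝ))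
    (f : C(USphere d, ℝ)) : Prop :=
  ∑' ℓ, ∑ k, ENNReal.ofReal ((1 + sphereEigenvalue d ℓ) ^ s * lfCoeff f (Y ℓ k) ^ 2) < ∞

/-- Admissible weights for a norm on `H^s(S^d)`: positive, with `a_ℓ ≍ (1 + λ_ℓ)^(-s)`. -/
def IsSobolevWeight (d : ℕ) (s : ℝ) (a : ℕ → ℝ) : Prop :=
  (∀ ℓ, 0 < a ℓ) ∧ ∃ c₁ c₂ : ℝ, 0 < c₁ ∧ 0 < c₂ ∧ ∀ ℓ,
    c₁ * (1 + sphereEigenvalue d ℓ) ^ (-s) ≤ a ℓ ∧ a ℓ ≤ c₂ * (1 + sphereEigenvalue d ℓ) ^ (-s)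

/-- The Sobolev norm `(∑_ℓ ∑_k (1 / a_ℓ) |f̂_{ℓ,k}|²)^(1/2)` (infinite when the series diverges). -/
noncomputable def sobolevNorm {d : ℕ} (a : ℕ → ℝ)
    (Y : (ℓ : ℕ) → Fin (harmonicDim d ℓ) → C(USphere d, ℝ)) (f : C(USphere d, ℝ)) : ℝ≥0∞ :=
  (∑' ℓ, ∑ k, ENNReal.ofReal (1 / a ℓ * lfCoeff f (Y ℓ k) ^ 2)) ^ (1 / 2 : ℝ)

/-- The worst-case error in `H^s(S^d)` of the equal weight rule with nodes `x_1, …, x_N`: the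
supremum of `|N⁻¹ ∑_j f(x_j) - ∫ f dσ_d|` over `f ∈ H^s(S^d)` of norm at most one. -/
noncomputable def worstCaseError {d : ℕ} (s : ℝ) (a : ℕ → ℝ)
    (Y : (ℓ : ℕ) → Fin (harmonicDim d ℓ) → C(USphere d, ℝ)) {N : ℕ} (x : Fin N → USphere d) :
    ℝ≥0∞ :=
  ⨆ (f : C(USphere d, ℝ)) (_ : MemSobolev s Y f) (_ : sobolevNorm a Y f ≤ 1),
    ENNReal.ofReal |(1 / (N : ℝ)) * ∑ j, f (x j) - ∫ y, f y ∂(sphereMeasure d)|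

/-- `(X_N)`, `N ∈ I`, with `I` an infinite set of natural numbers, is a sequence of QMC designs for
`H^s(S^d)`: the worst-case error of the `N`-point configuration `X_N` is at most `c / N^(s/d)` with
`c` independent of `N`. -/
def IsQMCDesignSequence {d : ℕ} (s : ℝ) (a : ℕ → ℝ)
    (Y : (ℓ : ℕ) → Fin (harmonicDim d ℓ) → C(USphere d, ℝ)) (I : Set ℕ)
    (X : (N : ℕ) → Fin N → USphere d) : Prop :=
  I.Infinite ∧ ∃ c : ℝ, 0 < c ∧ ∀ N ∈ I, 1 ≤ N →
    worstCaseError s a Y (X N) ≤ ENNReal.ofReal (c / (N : ℝ) ^ (s / (d : ℝ)))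

/-- The random points `x_1, …, x_N` are independent and uniformly distributed on `S^d`. -/
def IsIIDUniform {d N : ℕ} {Ω : Type u} [MeasurableSpace Ω] (P : Measure Ω)
    (x : Fin N → Ω → USphere d) : Prop :=
  (∀ j, HasLaw (x j) (sphereMeasure d) P) ∧ iIndepFun x P

instance sphereMeasure.instIsProbabilityMeasure (d : ℕ) :
    IsProbabilityMeasure (sphereMeasure d) where
  measure_univ := by
    rw [sphereMeasure, Measure.smul_apply, smul_eq_mul]
    refine ENNReal.inv_mul_cancel ?_ (measure_ne_top _ _)
    simp only [ne_eq, Measure.measure_univ_eq_zero]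
    exact Measure.toSphere_ne_zero _

instance sphereMeasure.instIsOpenPosMeasure (d : ℕ) : (sphereMeasure d).IsOpenPosMeasure := by
  refine ⟨fun U hU hne => ?_⟩
  rw [sphereMeasure, Measure.smul_apply, smul_eq_mul]
  exact mul_ne_zero (ENNReal.inv_ne_zero.2 (measure_ne_top _ _)) (hU.measure_ne_zero _ hne)

/-- The action of a linear isometry on the sphere. -/
noncomputable def sphereMap {d : ℕ}
    (R : EuclideanSpace ℝ (Fin (d + 1)) ≃ₗᵢ[ℝ] EuclideanSpace ℝ (Fin (d + 1))) :
    C(USphere d, USphere d) where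
  toFun x := ⟨R x.1, by simp⟩
  continuous_toFun := by fun_prop

open scoped Pointwise in
theorem measurePreserving_sphereMap {d : ℕ}
    (R : EuclideanSpace ℝ (Fin (d + 1)) ≃ₗᵢ[ℝ] EuclideanSpace ℝ (Fin (d + 1))) :
    MeasurePreserving (sphereMap R) (sphereMeasure d) (sphereMeasure d) := by
  refine ⟨(sphereMap R).continuous.measurable, ?_⟩
  ext t ht
  rw [Measure.map_apply (sphereMap R).continuous.measurable ht, sphereMeasure,
    Measure.smul_apply, Measure.smul_apply,
    Measure.toSphere_apply' _ ((sphereMap R).continuous.measurable ht),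
    Measure.toSphere_apply' _ ht]
  congr 2
  conv_rhs => rw [← R.measurePreserving.measure_preimage_emb R.toHomeomorph.measurableEmbedding]
  congr 1
  ext y
  simp only [Set.mem_smul, Set.mem_image, Set.mem_preimage]
  constructor
  · rintro ⟨r, hr, _, ⟨x, hx, rfl⟩, rfl⟩
    exact ⟨r, hr, _, ⟨sphereMap R x, hx, rfl⟩, by simp [sphereMap]⟩
  · rintro ⟨r, hr, _, ⟨x, hx, rfl⟩, hy⟩
    have hR : sphereMap R (sphereMap R.symm x) = x := by
      ext1; simp [sphereMap]
    refine ⟨r, hr, _, ⟨sphereMap R.symm x, by rwa [hR], rfl⟩, ?_⟩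
    apply R.injective
    simpa [sphereMap] using hy

theorem integrable_sphere {d : ℕ} (f : C(USphere d, ℝ)) : Integrable f (sphereMeasure d) :=
  f.continuous.integrable_of_hasCompactSupport (HasCompactSupport.of_compactSpace _)

/-- Integration against the normalized surface measure as a continuous linear functional. -/
noncomputable def sphereIntegral (d : ℕ) : C(USphere d, ℝ) →L[ℝ] ℝ :=
  LinearMap.mkContinuous
    { toFun := fun f => ∫ x, f x ∂(sphereMeasure d)
      map_add' := fun f g => integral_add (integrable_sphere f) (integrable_sphere g)
      map_smul' := fun c f => integral_const_mul c _ } 1 fun f => by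
    have := norm_integral_le_of_norm_le_const (μ := sphereMeasure d) (f := f) (C := ‖f‖)
      (.of_forall fun x => f.norm_coe_le_norm x)
    simpa using this

theorem sphereIntegral_apply {d : ℕ} (f : C(USphere d, ℝ)) :
    sphereIntegral d f = ∫ x, f x ∂(sphereMeasure d) := rfl

theorem sphereIntegral_comp {d : ℕ}
    (R : EuclideanSpace ℝ (Fin (d + 1)) ≃ₗᵢ[ℝ] EuclideanSpace ℝ (Fin (d + 1)))
    (f : C(USphere d, ℝ)) :
    sphereIntegral d (f.comp (sphereMap R)) = sphereIntegral d f := by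
  simp only [sphereIntegral_apply, ContinuousMap.comp_apply]
  have h := measurePreserving_sphereMap R
  conv_rhs => rw [← h.map_eq]
  exact (integral_map h.measurable.aemeasurable f.continuous.aestronglyMeasurable).symm

theorem lfCoeff_eq_sphereIntegral {d : ℕ} (f Y : C(USphere d, ℝ)) :
    lfCoeff f Y = sphereIntegral d (f * Y) := rfl

theorem eq_zero_of_sphereIntegral_mul_self {d : ℕ} {f : C(USphere d, ℝ)}
    (h : sphereIntegral d (f * f) = 0) : f = 0 := by
  have h1 := (integral_eq_zero_iff_of_nonneg (fun x => mul_self_nonneg (f x))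
    (integrable_sphere (f * f))).1 h
  have h2 := (f * f).continuous.ae_eq_iff_eq (sphereMeasure d) continuous_const |>.1 h1
  ext x
  exact mul_self_eq_zero.1 (congrFun h2 x)

/-- A coordinate function on the sphere. -/
noncomputable def sphereCoord (d : ℕ) (i : Fin (d + 1)) : C(USphere d, ℝ) where
  toFun x := x.1 i
  continuous_toFun := by fun_prop

/-- Restriction of polynomials to the sphere. -/
noncomputable def sphereEval (d : ℕ) : MvPolynomial (Fin (d + 1)) ℝ →ₐ[ℝ] C(USphere d, ℝ) :=
  MvPolynomial.aeval (sphereCoord d)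

theorem aeval_continuousMap_apply {d : ℕ} {σ : Type*} (c : σ → C(USphere d, ℝ))
    (p : MvPolynomial σ ℝ) (x : USphere d) :
    MvPolynomial.aeval c p x = MvPolynomial.eval (fun i => c i x) p := by
  induction p using MvPolynomial.induction_on with
  | C a => simp [MvPolynomial.algHom_C]
  | add p q hp hq => simp [hp, hq]
  | mul_X p i hp => simp [hp]

theorem sphereEval_apply {d : ℕ} (p : MvPolynomial (Fin (d + 1)) ℝ) (x : USphere d) :
    sphereEval d p x = MvPolynomial.eval (fun i => x.1 i) p :=
  aeval_continuousMap_apply _ _ _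

/-- The Laplacian on polynomials. -/
noncomputable def polyLaplacian (d : ℕ) :
    MvPolynomial (Fin (d + 1)) ℝ →ₗ[ℝ] MvPolynomial (Fin (d + 1)) ℝ :=
  ∑ i, (MvPolynomial.pderiv i).toLinearMap ∘ₗ (MvPolynomial.pderiv i).toLinearMap

theorem polyLaplacian_apply {d : ℕ} (p : MvPolynomial (Fin (d + 1)) ℝ) :
    polyLaplacian d p = ∑ i, MvPolynomial.pderiv i (MvPolynomial.pderiv i p) := by
  simp [polyLaplacian]

theorem mem_sphericalHarmonics_iff {d ℓ : ℕ} {Y : C(USphere d, ℝ)} :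
    Y ∈ sphericalHarmonics d ℓ ↔ ∃ p : MvPolynomial (Fin (d + 1)) ℝ, p.IsHomogeneous ℓ ∧
      polyLaplacian d p = 0 ∧ sphereEval d p = Y := by
  change (∃ p : MvPolynomial (Fin (d + 1)) ℝ, _) ↔ _
  refine exists_congr fun p => ?_
  rw [polyLaplacian_apply, ContinuousMap.ext_iff]
  simp only [sphereEval_apply, eq_comm]

/-- The squared norm as a polynomial. -/
noncomputable def normSqPoly (d : ℕ) : MvPolynomial (Fin (d + 1)) ℝ :=
  ∑ i, MvPolynomial.X i * MvPolynomial.X i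

theorem sphereEval_normSqPoly (d : ℕ) : sphereEval d (normSqPoly d) = 1 := by
  ext x
  have := EuclideanSpace.norm_sq_eq x.1
  simp only [norm_eq_of_mem_sphere, one_pow, Real.norm_eq_abs, sq_abs] at this
  simp [sphereEval_apply, normSqPoly, ← pow_two, ← this]

theorem isHomogeneous_normSqPoly (d : ℕ) : (normSqPoly d).IsHomogeneous 2 :=
  MvPolynomial.IsHomogeneous.sum _ _ _ fun i _ =>
    (MvPolynomial.isHomogeneous_X ℝ i).mul (MvPolynomial.isHomogeneous_X ℝ i)

theorem sphereEval_normSqPoly_mul {d : ℕ} (p : MvPolynomial (Fin (d + 1)) ℝ) :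
    sphereEval d (normSqPoly d * p) = sphereEval d p := by
  rw [map_mul, sphereEval_normSqPoly, one_mul]

theorem MvPolynomial.IsHomogeneous.eval_mul {σ : Type*} {m : ℕ} {p : MvPolynomial σ ℝ}
    (hp : p.IsHomogeneous m) (r : ℝ) (y : σ → ℝ) :
    MvPolynomial.eval (fun i => r * y i) p = r ^ m * MvPolynomial.eval y p := by
  rw [MvPolynomial.eval_eq, MvPolynomial.eval_eq, Finset.mul_sum]
  refine Finset.sum_congr rfl fun s hs => ?_
  simp only [mul_pow, Finset.prod_mul_distrib, Finset.prod_pow_eq_pow_sum]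
  rw [← hp.degree_eq_sum_deg_support hs]
  ring

/-- A homogeneous polynomial vanishing on the sphere is zero. -/
theorem eq_zero_of_sphereEval_eq_zero {d m : ℕ} {p : MvPolynomial (Fin (d + 1)) ℝ}
    (hp : p.IsHomogeneous m) (h : sphereEval d p = 0) : p = 0 := by
  have key : ∀ y : Fin (d + 1) → ℝ, y ≠ 0 → MvPolynomial.eval y p = 0 := by
    intro y hy
    set z : EuclideanSpace ℝ (Fin (d + 1)) := WithLp.toLp 2 y
    have hz : ‖z‖ ≠ 0 := by simpa [z] using hy
    have hx := DFunLike.congr_fun h ⟨‖z‖⁻¹ • z, by simp [norm_smul, hz]⟩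
    rw [sphereEval_apply, ContinuousMap.zero_apply] at hx
    have h2 := hp.eval_mul ‖z‖ fun i => (‖z‖⁻¹ • z) i
    have h3 : (fun i => ‖z‖ * (‖z‖⁻¹ • z) i) = y := by
      ext i
      simp [hz, z]
    rwa [h3, hx, mul_zero] at h2
  have h4 : MvPolynomial.X 0 * p = 0 := by
    refine MvPolynomial.funext fun y => ?_
    by_cases hy : y = 0
    · simp [hy]
    · simp [key y hy]
  simpa using h4

/-- The chain rule for polynomials in elements of a commutative normed algebra. -/
theorem MvPolynomial.hasDerivAt_aeval {σ A : Type*} [Fintype σ] [NormedCommRing A]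
    [NormedAlgebra ℝ A] {c : ℝ → σ → A} {c' : σ → A} {t : ℝ}
    (hc : ∀ k, HasDerivAt (fun u => c u k) (c' k) t) (p : MvPolynomial σ ℝ) :
    HasDerivAt (fun u => MvPolynomial.aeval (c u) p)
      (∑ k, c' k * MvPolynomial.aeval (c t) (MvPolynomial.pderiv k p)) t := by
  classical
  induction p using MvPolynomial.induction_on with
  | C a =>
    simpa using hasDerivAt_const t (algebraMap ℝ A a)
  | add p q hp hq =>
    simp only [map_add, mul_add, Finset.sum_add_distrib]
    exact hp.add hq
  | mul_X p i hp =>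
    have := hp.mul (hc i)
    simp only [map_mul, MvPolynomial.aeval_X, Derivation.leibniz, smul_eq_mul, map_add,
      MvPolynomial.pderiv_X, mul_add, Finset.sum_add_distrib]
    refine this.congr_deriv ?_
    rw [add_comm]
    congr 1
    · rw [Finset.sum_eq_single i]
      · simp [mul_comm]
      · intro b _ hb
        simp [hb.symm]
      · simp
    · rw [Finset.sum_mul]
      exact Finset.sum_congr rfl fun k _ => by ring

/-- The isometry `x ↦ 2 ⟪u, x⟫ / ‖u‖² u - x` with `u = e_i + t e_j`. -/
noncomputable def lineReflection (d : ℕ) (i j : Fin (d + 1)) (t : ℝ) :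
    EuclideanSpace ℝ (Fin (d + 1)) ≃ₗᵢ[ℝ] EuclideanSpace ℝ (Fin (d + 1)) :=
  Submodule.reflection (Submodule.span ℝ
    {EuclideanSpace.single i (1 : ℝ) + t • EuclideanSpace.single j (1 : ℝ)})

theorem lineReflection_apply {d : ℕ} {i j : Fin (d + 1)} (hij : i ≠ j) (t : ℝ)
    (x : EuclideanSpace ℝ (Fin (d + 1))) (k : Fin (d + 1)) :
    lineReflection d i j t x k = 2 * ((if k = i then 1 else 0) + t * if k = j then 1 else 0) /
      (1 + t ^ 2) * (x i + t * x j) - x k := by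
  have hnorm : ‖EuclideanSpace.single i (1 : ℝ) + t • EuclideanSpace.single j (1 : ℝ)‖ ^ 2 =
      1 + t ^ 2 := by
    rw [@norm_add_sq_real]
    simp [inner_smul_right, hij, norm_smul, EuclideanSpace.inner_single_left]
  rw [lineReflection, Submodule.reflection_singleton_apply]
  simp only [RCLike.ofReal_real_eq_id, id_eq, hnorm]
  simp [inner_add_left, inner_smul_left, EuclideanSpace.inner_single_left]
  split_ifs <;> ring

theorem sphereEval_comp_sphereMap {d : ℕ} (p : MvPolynomial (Fin (d + 1)) ℝ)
    (R : EuclideanSpace ℝ (Fin (d + 1)) ≃ₗᵢ[ℝ] EuclideanSpace ℝ (Fin (d + 1))) :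
    (sphereEval d p).comp (sphereMap R) =
      MvPolynomial.aeval (fun k => (sphereCoord d k).comp (sphereMap R)) p := by
  ext x
  simp only [ContinuousMap.comp_apply, sphereEval_apply, aeval_continuousMap_apply]
  rfl

theorem sphereIntegral_mul_pderiv_swap {d : ℕ} (i j : Fin (d + 1))
    (p : MvPolynomial (Fin (d + 1)) ℝ) :
    sphereIntegral d (sphereEval d (MvPolynomial.X i * MvPolynomial.pderiv j p)) =
      sphereIntegral d (sphereEval d (MvPolynomial.X j * MvPolynomial.pderiv i p)) := by
  rcases eq_or_ne i j with rfl | hij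
  · rfl
  set c : ℝ → Fin (d + 1) → C(USphere d, ℝ) := fun t k =>
    (2 * ((if k = i then 1 else 0) + t * if k = j then 1 else 0) / (1 + t ^ 2)) •
      (sphereCoord d i + t • sphereCoord d j) - sphereCoord d k with hc
  have hcR : ∀ t k, c t k = (sphereCoord d k).comp (sphereMap (lineReflection d i j t)) := by
    intro t k
    ext x
    change _ = lineReflection d i j t x.1 k
    rw [lineReflection_apply hij]
    rfl
  have hcp : ∀ t, MvPolynomial.aeval (c t) p =
      (sphereEval d p).comp (sphereMap (lineReflection d i j t)) := by
    intro t
    rw [sphereEval_comp_sphereMap]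
    congr 1
    congr 1
    exact funext fun k => hcR t k
  have hderiv : ∀ k, HasDerivAt (fun u => c u k)
      ((2 * if k = j then (1 : ℝ) else 0) • sphereCoord d i +
        (2 * if k = i then (1 : ℝ) else 0) • sphereCoord d j) 0 := by
    intro k
    set α : ℝ := if k = i then 1 else 0
    set β : ℝ := if k = j then 1 else 0
    have h1 : HasDerivAt (fun t : ℝ => 2 * (α + t * β) / (1 + t ^ 2)) (2 * β) 0 := by
      have ha : HasDerivAt (fun t : ℝ => 2 * (α + t * β)) (2 * (1 * β)) 0 :=
        (((hasDerivAt_id (0 : ℝ)).mul_const β).const_add α).const_mul 2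
      have hb : HasDerivAt (fun t : ℝ => 1 + t ^ 2) (((2 : ℕ) : ℝ) * 0 ^ (2 - 1)) 0 :=
        (hasDerivAt_pow 2 (0 : ℝ)).const_add 1
      have := ha.div hb (by norm_num)
      refine this.congr_deriv ?_
      norm_num
    have h2 : HasDerivAt (fun t : ℝ => sphereCoord d i + t • sphereCoord d j)
        ((1 : ℝ) • sphereCoord d j) 0 :=
      ((hasDerivAt_id (0 : ℝ)).smul_const (sphereCoord d j)).const_add _
    have := (h1.smul h2).sub_const (sphereCoord d k)
    refine this.congr_deriv ?_
    simp only [zero_mul, add_zero, zero_smul, one_smul, ne_eq, OfNat.ofNat_ne_zero,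
      not_false_eq_true, zero_pow, div_one]
    exact add_comm _ _
  have hD := MvPolynomial.hasDerivAt_aeval hderiv p
  have hI := (sphereIntegral d).hasFDerivAt.comp_hasDerivAt (0 : ℝ) hD
  have hconst : (fun u => sphereIntegral d (MvPolynomial.aeval (c u) p)) =
      fun _ => sphereIntegral d (sphereEval d p) := by
    funext u
    rw [hcp, sphereIntegral_comp]
  have h0 := hI.unique (by
    change HasDerivAt (fun u => sphereIntegral d (MvPolynomial.aeval (c u) p)) 0 0
    rw [hconst]
    exact hasDerivAt_const _ _)
  have hcoord : ∀ k, (c 0 k).comp (sphereMap (lineReflection d i j 0)) = sphereCoord d k := by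
    intro k
    ext x
    have hx : ∀ m, (sphereMap (lineReflection d i j 0) x).1 m =
        2 * (if m = i then 1 else 0) * x.1 i - x.1 m := by
      intro m
      change lineReflection d i j 0 x.1 m = _
      rw [lineReflection_apply hij]
      simp
    simp only [ContinuousMap.comp_apply, hc, sphereCoord, ContinuousMap.sub_apply,
      ContinuousMap.smul_apply, ContinuousMap.add_apply, ContinuousMap.coe_mk, hx, smul_eq_mul]
    simp
    split_ifs with h
    · subst h; ring
    · ring
  have hpoly : ∀ q : MvPolynomial (Fin (d + 1)) ℝ,
      (MvPolynomial.aeval (c 0) q).comp (sphereMap (lineReflection d i j 0)) =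
        sphereEval d q := by
    intro q
    ext x
    have := fun k => DFunLike.congr_fun (hcoord k) x
    simp only [ContinuousMap.comp_apply] at this
    simp only [ContinuousMap.comp_apply, aeval_continuousMap_apply, this, sphereEval_apply]
    rfl
  have hi : (sphereCoord d i).comp (sphereMap (lineReflection d i j 0)) = sphereCoord d i := by
    rw [← hcR]; ext; simp [hc, sphereCoord]; ring
  have hj : (sphereCoord d j).comp (sphereMap (lineReflection d i j 0)) = -sphereCoord d j := by
    rw [← hcR]; ext; simp [hc, sphereCoord, hij.symm]
  rw [← sphereIntegral_comp (lineReflection d i j 0)] at h0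
  have hsum : (∑ k, ((2 * if k = j then (1 : ℝ) else 0) • sphereCoord d i +
        (2 * if k = i then (1 : ℝ) else 0) • sphereCoord d j) *
        MvPolynomial.aeval (c 0) (MvPolynomial.pderiv k p)) =
      (2 : ℝ) • (sphereCoord d i * MvPolynomial.aeval (c 0) (MvPolynomial.pderiv j p) +
        sphereCoord d j * MvPolynomial.aeval (c 0) (MvPolynomial.pderiv i p)) := by
    simp [add_mul, Finset.sum_add_distrib, ite_smul]
  have hcomp : ((2 : ℝ) • (sphereCoord d i *
        MvPolynomial.aeval (c 0) (MvPolynomial.pderiv j p) +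
        sphereCoord d j * MvPolynomial.aeval (c 0) (MvPolynomial.pderiv i p))).comp
        (sphereMap (lineReflection d i j 0)) =
      (2 : ℝ) • (sphereEval d (MvPolynomial.X i * MvPolynomial.pderiv j p) -
        sphereEval d (MvPolynomial.X j * MvPolynomial.pderiv i p)) := by
    rw [ContinuousMap.smul_comp, ContinuousMap.add_comp, ContinuousMap.mul_comp,
      ContinuousMap.mul_comp, hpoly, hpoly, hi, hj, map_mul, map_mul]
    simp [sphereEval, sub_eq_add_neg]
  rw [hsum, hcomp, map_smul, map_sub] at h0
  have := (smul_eq_zero.1 h0).resolve_left two_ne_zero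
  linarith

theorem sphereEval_sum_X_mul_X {d : ℕ} (p : MvPolynomial (Fin (d + 1)) ℝ) :
    sphereEval d (∑ i, MvPolynomial.X i * (MvPolynomial.X i * p)) = sphereEval d p := by
  rw [← sphereEval_normSqPoly_mul p, normSqPoly, Finset.sum_mul]
  simp only [mul_assoc]

theorem sphereIntegral_pderiv {d m : ℕ} {p : MvPolynomial (Fin (d + 1)) ℝ}
    (hp : p.IsHomogeneous m) (j : Fin (d + 1)) :
    sphereIntegral d (sphereEval d (MvPolynomial.pderiv j p)) =
      (d + m : ℝ) * sphereIntegral d (sphereEval d (MvPolynomial.X j * p)) := by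
  classical
  have h := Finset.sum_congr (rfl : (Finset.univ : Finset (Fin (d + 1))) = Finset.univ)
    fun i _ => sphereIntegral_mul_pderiv_swap i j (MvPolynomial.X i * p)
  simp only [← map_sum] at h
  have h1 : ∑ i, MvPolynomial.X i * MvPolynomial.pderiv j (MvPolynomial.X i * p) =
      MvPolynomial.X j * p + ∑ i, MvPolynomial.X i * (MvPolynomial.X i *
        MvPolynomial.pderiv j p) := by
    simp only [MvPolynomial.pderiv_mul, MvPolynomial.pderiv_X, mul_add, Finset.sum_add_distrib]
    congr 1
    rw [Finset.sum_eq_single j] <;> simp +contextual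
  have h2 : ∑ i, MvPolynomial.X j * MvPolynomial.pderiv i (MvPolynomial.X i * p) =
      (d + 1 + m : ℝ) • (MvPolynomial.X j * p) := by
    rw [← Finset.mul_sum]
    simp only [MvPolynomial.pderiv_mul, MvPolynomial.pderiv_X_self, Finset.sum_add_distrib,
      hp.sum_X_mul_pderiv]
    simp [MvPolynomial.smul_eq_C_mul]
    ring
  rw [h1, h2, map_add, sphereEval_sum_X_mul_X, map_smul, map_add, map_smul, smul_eq_mul] at h
  linarith

/-- Spherical harmonics of different degrees are orthogonal. -/
theorem sphereIntegral_mul_eq_zero {d ℓ m : ℕ} (hd : 2 ≤ d) (hne : ℓ ≠ m) {f g : C(USphere d, ℝ)}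
    (hf : f ∈ sphericalHarmonics d ℓ) (hg : g ∈ sphericalHarmonics d m) :
    sphereIntegral d (f * g) = 0 := by
  obtain ⟨p, hp, hp0, rfl⟩ := mem_sphericalHarmonics_iff.1 hf
  obtain ⟨q, hq, hq0, rfl⟩ := mem_sphericalHarmonics_iff.1 hg
  have hhom : ∀ {k n : ℕ} {r s : MvPolynomial (Fin (d + 1)) ℝ}, r.IsHomogeneous k →
      s.IsHomogeneous n → ∀ j, (r * MvPolynomial.pderiv j s).IsHomogeneous (k + n - 1) := by
    intro k n r s hr hs j
    rcases n with _ | n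
    · rw [← MvPolynomial.totalDegree_zero_iff_isHomogeneous,
        MvPolynomial.totalDegree_eq_zero_iff_eq_C] at hs
      rw [hs, MvPolynomial.pderiv_C, mul_zero]
      exact MvPolynomial.isHomogeneous_zero _ _ _
    · exact hr.mul hs.pderiv
  have hF : ∀ j, (p * MvPolynomial.pderiv j q - q * MvPolynomial.pderiv j p).IsHomogeneous
      (ℓ + m - 1) := fun j => (hhom hp hq j).sub (by rw [add_comm ℓ m]; exact hhom hq hp j)
  have h := Finset.sum_congr (rfl : (Finset.univ : Finset (Fin (d + 1))) = Finset.univ)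
    fun j _ => sphereIntegral_pderiv (hF j) j
  rw [← Finset.mul_sum] at h
  simp only [← map_sum] at h
  have h1 : ∑ j, MvPolynomial.pderiv j
      (p * MvPolynomial.pderiv j q - q * MvPolynomial.pderiv j p) = 0 := by
    rw [polyLaplacian_apply] at hp0 hq0
    have : ∀ j, MvPolynomial.pderiv j
        (p * MvPolynomial.pderiv j q - q * MvPolynomial.pderiv j p) =
        p * MvPolynomial.pderiv j (MvPolynomial.pderiv j q) -
          q * MvPolynomial.pderiv j (MvPolynomial.pderiv j p) := by
      intro j
      rw [map_sub, MvPolynomial.pderiv_mul, MvPolynomial.pderiv_mul]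
      ring
    simp only [this, Finset.sum_sub_distrib, ← Finset.mul_sum, hp0, hq0, mul_zero, sub_zero]
  have h2 : ∑ j, MvPolynomial.X j *
      (p * MvPolynomial.pderiv j q - q * MvPolynomial.pderiv j p) =
      ((m : ℝ) - ℓ) • (p * q) := by
    have : ∀ j, MvPolynomial.X j *
        (p * MvPolynomial.pderiv j q - q * MvPolynomial.pderiv j p) =
        p * (MvPolynomial.X j * MvPolynomial.pderiv j q) -
          q * (MvPolynomial.X j * MvPolynomial.pderiv j p) := fun j => by ring
    simp only [this, Finset.sum_sub_distrib, ← Finset.mul_sum, hp.sum_X_mul_pderiv,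
      hq.sum_X_mul_pderiv]
    simp [MvPolynomial.smul_eq_C_mul]
    ring
  rw [h1, h2, map_zero, map_zero, map_smul, map_smul, smul_eq_mul, map_mul] at h
  have hd' : (2 : ℝ) ≤ d := by exact_mod_cast hd
  have hc : (0 : ℝ) ≤ ((ℓ + m - 1 : ℕ) : ℝ) := Nat.cast_nonneg _
  have hml : (m : ℝ) - ℓ ≠ 0 := sub_ne_zero.2 (by exact_mod_cast hne.symm)
  have := (mul_eq_zero.1 h.symm).resolve_left (by linarith)
  exact (mul_eq_zero.1 this).resolve_left hml

/-- Integration against a fixed function as a continuous linear functional. -/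
noncomputable def sphereIntegralMul {d : ℕ} (g : C(USphere d, ℝ)) : C(USphere d, ℝ) →L[ℝ] ℝ :=
  (sphereIntegral d).comp (ContinuousLinearMap.mul ℝ _ g)

theorem sphereIntegralMul_apply {d : ℕ} (f g : C(USphere d, ℝ)) :
    sphereIntegralMul g f = sphereIntegral d (g * f) := rfl

theorem lfCoeff_eq_sphereIntegralMul {d : ℕ} (f Y : C(USphere d, ℝ)) :
    lfCoeff f Y = sphereIntegralMul Y f := by
  rw [lfCoeff_eq_sphereIntegral, sphereIntegralMul_apply, mul_comm]

theorem polyLaplacian_eq_zero_of_isHomogeneous {d m : ℕ} (hm : m < 2)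
    {p : MvPolynomial (Fin (d + 1)) ℝ} (hp : p.IsHomogeneous m) : polyLaplacian d p = 0 := by
  rw [polyLaplacian_apply]
  refine Finset.sum_eq_zero fun i _ => ?_
  have h : (MvPolynomial.pderiv i p).IsHomogeneous 0 := by
    have := hp.pderiv (i := i)
    rwa [show m - 1 = 0 by omega] at this
  rw [← MvPolynomial.totalDegree_zero_iff_isHomogeneous,
    MvPolynomial.totalDegree_eq_zero_iff_eq_C] at h
  rw [h, MvPolynomial.pderiv_C]

theorem isHomogeneous_polyLaplacian {d m : ℕ} {p : MvPolynomial (Fin (d + 1)) ℝ}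
    (hp : p.IsHomogeneous (m + 2)) : (polyLaplacian d p).IsHomogeneous m := by
  rw [polyLaplacian_apply]
  exact MvPolynomial.IsHomogeneous.sum _ _ _ fun i _ => hp.pderiv.pderiv

/-- Spherical harmonics of degree at most `k`. -/
noncomputable def harmonicsUpTo (d k : ℕ) : Submodule ℝ C(USphere d, ℝ) :=
  ⨆ (ℓ : ℕ) (_ : ℓ ≤ k), sphericalHarmonics d ℓ

theorem sphericalHarmonics_le_harmonicsUpTo {d ℓ k : ℕ} (h : ℓ ≤ k) :
    sphericalHarmonics d ℓ ≤ harmonicsUpTo d k :=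
  le_iSup₂ (f := fun (ℓ : ℕ) (_ : ℓ ≤ k) => sphericalHarmonics d ℓ) ℓ h

theorem harmonicsUpTo_mono (d : ℕ) : Monotone (harmonicsUpTo d) := fun _ _ hkm =>
  iSup₂_le fun _ hℓ => sphericalHarmonics_le_harmonicsUpTo (hℓ.trans hkm)

theorem sphereIntegral_mul_eq_zero_of_mem_harmonicsUpTo {d k m : ℕ} (hd : 2 ≤ d) (hkm : k < m)
    {f g : C(USphere d, ℝ)} (hf : f ∈ harmonicsUpTo d k) (hg : g ∈ sphericalHarmonics d m) :
    sphereIntegral d (g * f) = 0 := by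
  have : harmonicsUpTo d k ≤ LinearMap.ker (sphereIntegralMul g).toLinearMap :=
    iSup₂_le fun ℓ hℓ h hh => sphereIntegral_mul_eq_zero hd (by omega) hg hh
  exact this hf

/-- The restriction to the sphere of a homogeneous polynomial of degree `k` is a sum of spherical
harmonics of degree at most `k`. -/
theorem sphereEval_mem_harmonicsUpTo {d : ℕ} (hd : 2 ≤ d) (k : ℕ) :
    ∀ p : MvPolynomial (Fin (d + 1)) ℝ, p.IsHomogeneous k →
      sphereEval d p ∈ harmonicsUpTo d k := by
  induction k using Nat.twoStepInduction with
  | zero =>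
    exact fun p hp => sphericalHarmonics_le_harmonicsUpTo le_rfl (mem_sphericalHarmonics_iff.2
      ⟨p, hp, polyLaplacian_eq_zero_of_isHomogeneous two_pos hp, rfl⟩)
  | one =>
    exact fun p hp => sphericalHarmonics_le_harmonicsUpTo le_rfl (mem_sphericalHarmonics_iff.2
      ⟨p, hp, polyLaplacian_eq_zero_of_isHomogeneous one_lt_two hp, rfl⟩)
  | more k ih _ =>
    intro p hp
    have hhom : ∀ q : MvPolynomial (Fin (d + 1)) ℝ, q.IsHomogeneous k →
        (normSqPoly d * q).IsHomogeneous (k + 2) := fun q hq => by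
      rw [add_comm k 2]; exact (isHomogeneous_normSqPoly d).mul hq
    let T : MvPolynomial.homogeneousSubmodule (Fin (d + 1)) ℝ k →ₗ[ℝ]
        MvPolynomial.homogeneousSubmodule (Fin (d + 1)) ℝ k :=
      (polyLaplacian d ∘ₗ LinearMap.mulLeft ℝ (normSqPoly d)).restrict
        fun q hq => isHomogeneous_polyLaplacian (hhom q hq)
    have : Module.Finite ℝ (MvPolynomial.homogeneousSubmodule (Fin (d + 1)) ℝ k) :=
      Module.Finite.of_fg (MvPolynomial.homogeneousSubmodule_fg _ _ k)
    have hinj : Function.Injective T := by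
      rw [← LinearMap.ker_eq_bot, LinearMap.ker_eq_bot']
      rintro ⟨q, hq⟩ hTq
      have hTq' : polyLaplacian d (normSqPoly d * q) = 0 := congrArg Subtype.val hTq
      have hmem : sphereEval d q ∈ sphericalHarmonics d (k + 2) :=
        mem_sphericalHarmonics_iff.2 ⟨_, hhom q hq, hTq', sphereEval_normSqPoly_mul q⟩
      have h0 := sphereIntegral_mul_eq_zero_of_mem_harmonicsUpTo hd (by omega) (ih q hq) hmem
      exact Subtype.ext (eq_zero_of_sphereEval_eq_zero hq (eq_zero_of_sphereIntegral_mul_self h0))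
    obtain ⟨⟨q, hq⟩, hTq⟩ := LinearMap.injective_iff_surjective.1 hinj
      ⟨polyLaplacian d p, isHomogeneous_polyLaplacian hp⟩
    have hTq' : polyLaplacian d (normSqPoly d * q) = polyLaplacian d p := congrArg Subtype.val hTq
    have hsplit : sphereEval d p = sphereEval d (p - normSqPoly d * q) + sphereEval d q := by
      rw [map_sub, sphereEval_normSqPoly_mul, sub_add_cancel]
    rw [hsplit]
    refine add_mem (sphericalHarmonics_le_harmonicsUpTo le_rfl (mem_sphericalHarmonics_iff.2
      ⟨_, hp.sub (hhom q hq), by rw [map_sub, hTq', sub_self], rfl⟩)) ?_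
    exact harmonicsUpTo_mono d (by omega) (ih q hq)

/-- The polynomials are dense in the continuous functions on the sphere. -/
theorem denseRange_sphereEval (d : ℕ) : DenseRange (sphereEval d) := by
  have h := ContinuousMap.subalgebra_topologicalClosure_eq_top_of_separatesPoints
    (sphereEval d).range (by
      intro x y hxy
      obtain ⟨i, hi⟩ : ∃ i, x.1 i ≠ y.1 i := by
        by_contra! hcon
        exact hxy (Subtype.ext (PiLp.ext hcon))
      exact ⟨sphereCoord d i, ⟨_, ⟨MvPolynomial.X i, by simp [sphereEval]⟩, rfl⟩, hi⟩)
  intro f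
  have : f ∈ (sphereEval d).range.topologicalClosure := by rw [h]; trivial
  simpa [← SetLike.mem_coe, Subalgebra.topologicalClosure_coe] using this

/-- A continuous function orthogonal to all spherical harmonics is zero. -/
theorem eq_zero_of_forall_sphereIntegral_mul {d : ℕ} (hd : 2 ≤ d) {f : C(USphere d, ℝ)}
    (h : ∀ ℓ, ∀ Y ∈ sphericalHarmonics d ℓ, sphereIntegral d (f * Y) = 0) : f = 0 := by
  have hpoly : ∀ p, sphereIntegralMul f (sphereEval d p) = 0 := by
    intro p
    rw [← MvPolynomial.sum_homogeneousComponent p, map_sum, map_sum]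
    refine Finset.sum_eq_zero fun k _ => ?_
    have hle : harmonicsUpTo d k ≤ LinearMap.ker (sphereIntegralMul f).toLinearMap :=
      iSup₂_le fun ℓ _ Y hY => h ℓ Y hY
    exact hle (sphereEval_mem_harmonicsUpTo hd k _
      (MvPolynomial.homogeneousComponent_isHomogeneous k p))
  have hall : ∀ g, sphereIntegralMul f g = 0 := fun g =>
    congrFun ((denseRange_sphereEval d).equalizer (sphereIntegralMul f).continuous
      (continuous_const (y := (0 : ℝ))) (funext hpoly)) g
  exact eq_zero_of_sphereIntegral_mul_self (hall f)

/-- A harmonic polynomial is determined by its coefficients of degree at most one in the zeroth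
variable. -/
theorem eq_zero_of_polyLaplacian_eq_zero {d : ℕ} {p : MvPolynomial (Fin (d + 1)) ℝ}
    (hp : polyLaplacian d p = 0) (h : ∀ m, m 0 ≤ 1 → p.coeff m = 0) : p = 0 := by
  have key : ∀ k, ∀ m : Fin (d + 1) →₀ ℕ, m 0 = k → p.coeff m = 0 := by
    intro k
    induction k using Nat.strong_induction_on with
    | _ k ih =>
      intro m hm
      by_cases hk : k ≤ 1
      · exact h m (by omega)
      obtain ⟨n, rfl⟩ : ∃ n, m = n + Finsupp.single 0 1 + Finsupp.single 0 1 := by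
        refine ⟨m - Finsupp.single 0 2, Finsupp.ext fun j => ?_⟩
        by_cases hj : 0 = j
        · subst hj; simp; omega
        · simp [hj]
      simp only [Finsupp.add_apply, Finsupp.single_eq_same] at hm
      have hc := congrArg (MvPolynomial.coeff n) hp
      rw [polyLaplacian_apply, MvPolynomial.coeff_sum, MvPolynomial.coeff_zero,
        Finset.sum_eq_single 0] at hc
      · simp only [MvPolynomial.coeff_pderiv, mul_eq_zero] at hc
        rcases hc with (hc | hc) | hc
        · exact hc
        · exact absurd hc (by positivity)
        · exact absurd hc (by positivity)
      · intro i _ hi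
        rw [MvPolynomial.coeff_pderiv, MvPolynomial.coeff_pderiv, ih (n 0) (by omega),
          zero_mul, zero_mul]
        simp [hi]
      · simp
  exact MvPolynomial.ext _ _ fun m => by rw [key _ m rfl, MvPolynomial.coeff_zero]

/-- Homogeneous harmonic polynomials of degree `ℓ`. -/
noncomputable def harmonicPolys (d ℓ : ℕ) : Submodule ℝ (MvPolynomial (Fin (d + 1)) ℝ) :=
  MvPolynomial.homogeneousSubmodule _ ℝ ℓ ⊓ LinearMap.ker (polyLaplacian d)

theorem sphericalHarmonics_eq_map (d ℓ : ℕ) :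
    sphericalHarmonics d ℓ = (harmonicPolys d ℓ).map (sphereEval d).toLinearMap := by
  ext Y
  rw [mem_sphericalHarmonics_iff, Submodule.mem_map]
  exact exists_congr fun p => and_assoc.symm

/-- The exponent of degree `ℓ` in `e + 2` variables with prescribed entries except the last. -/
noncomputable def exponentOf (e ℓ : ℕ) (t : Fin 2 × (Fin e → Fin (ℓ + 1))) : Fin (e + 2) →₀ ℕ :=
  Finsupp.equivFunOnFinite.symm (Fin.cons (t.1 : ℕ)
    (Fin.snoc (fun i => (t.2 i : ℕ)) (ℓ - t.1 - ∑ i, (t.2 i : ℕ)) : Fin (e + 1) → ℕ))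

/-- The coefficients of a polynomial at the exponents of degree at most one in the zeroth
variable. -/
noncomputable def lowCoeffs (e ℓ : ℕ) :
    MvPolynomial (Fin (e + 2)) ℝ →ₗ[ℝ] (Fin 2 × (Fin e → Fin (ℓ + 1)) → ℝ) :=
  LinearMap.pi fun t => MvPolynomial.lcoeff ℝ (exponentOf e ℓ t)

theorem exists_exponentOf_eq {e ℓ : ℕ} {m : Fin (e + 2) →₀ ℕ} (hm : m.degree = ℓ)
    (h0 : m 0 ≤ 1) : ∃ t, exponentOf e ℓ t = m := by
  have hdeg : m 0 + (∑ i : Fin e, m i.castSucc.succ + m (Fin.last e).succ) = ℓ := by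
    rw [← hm, Finsupp.degree_eq_sum, Fin.sum_univ_succ, Fin.sum_univ_castSucc]
  have hle : ∀ i : Fin e, m i.castSucc.succ < ℓ + 1 := fun i => by
    have := Finset.single_le_sum (f := fun i : Fin e => m i.castSucc.succ)
      (fun _ _ => Nat.zero_le _) (Finset.mem_univ i)
    omega
  refine ⟨(⟨m 0, by omega⟩, fun i => ⟨m i.castSucc.succ, hle i⟩), Finsupp.ext fun j => ?_⟩
  simp only [exponentOf, Finsupp.equivFunOnFinite_symm_apply_apply]
  refine Fin.cases ?_ (fun j => ?_) j
  · simp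
  · refine Fin.lastCases ?_ (fun j => ?_) j
    · simp only [Fin.cons_succ, Fin.snoc_last]
      omega
    · simp

theorem injective_lowCoeffs (e ℓ : ℕ) :
    Function.Injective ((lowCoeffs e ℓ).domRestrict (harmonicPolys (e + 1) ℓ)) := by
  rw [← LinearMap.ker_eq_bot, LinearMap.ker_eq_bot']
  rintro ⟨p, hp, hp0⟩ h
  refine Subtype.ext (eq_zero_of_polyLaplacian_eq_zero hp0 fun m hm => ?_)
  by_cases hdeg : m.degree = ℓ
  · obtain ⟨t, rfl⟩ := exists_exponentOf_eq hdeg hm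
    exact congrFun h t
  · exact MvPolynomial.IsHomogeneous.coeff_eq_zero hp hdeg

instance harmonicPolys.instFinite (e ℓ : ℕ) :
    Module.Finite ℝ (harmonicPolys (e + 1) ℓ) :=
  Module.Finite.of_injective _ (injective_lowCoeffs e ℓ)

theorem harmonicDim_le {d : ℕ} (hd : 2 ≤ d) (ℓ : ℕ) :
    harmonicDim d ℓ ≤ 2 * (ℓ + 1) ^ (d - 1) := by
  obtain ⟨e, rfl⟩ : ∃ e, d = e + 1 := ⟨d - 1, by omega⟩
  rw [harmonicDim, sphericalHarmonics_eq_map]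
  refine (Submodule.finrank_map_le _ _).trans ?_
  refine (LinearMap.finrank_le_finrank_of_injective (injective_lowCoeffs e ℓ)).trans ?_
  simp

theorem finite_sphericalHarmonics {d : ℕ} (hd : 2 ≤ d) (ℓ : ℕ) :
    Module.Finite ℝ (sphericalHarmonics d ℓ) := by
  obtain ⟨e, rfl⟩ : ∃ e, d = e + 1 := ⟨d - 1, by omega⟩
  rw [sphericalHarmonics_eq_map]
  infer_instance

theorem harmonicDim_one_pos {d : ℕ} (hd : 2 ≤ d) : 0 < harmonicDim d 1 := by
  have := finite_sphericalHarmonics hd 1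
  have hX := MvPolynomial.isHomogeneous_X ℝ (0 : Fin (d + 1))
  have hmem : sphereEval d (MvPolynomial.X 0) ∈ sphericalHarmonics d 1 :=
    mem_sphericalHarmonics_iff.2
      ⟨_, hX, polyLaplacian_eq_zero_of_isHomogeneous one_lt_two hX, rfl⟩
  have hne : sphereEval d (MvPolynomial.X 0) ≠ 0 := fun h =>
    MvPolynomial.X_ne_zero 0 (eq_zero_of_sphereEval_eq_zero hX h)
  have : Nontrivial (sphericalHarmonics d 1) :=
    ⟨⟨⟨_, hmem⟩, 0, fun h => hne (congrArg Subtype.val h)⟩⟩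
  exact Module.finrank_pos

/-- Spherical harmonics of degree zero are constant. -/
theorem exists_eq_const_of_mem_sphericalHarmonics_zero {d : ℕ} {f : C(USphere d, ℝ)}
    (hf : f ∈ sphericalHarmonics d 0) : ∃ c, f = ContinuousMap.const _ c := by
  obtain ⟨p, hp, -, rfl⟩ := mem_sphericalHarmonics_iff.1 hf
  rw [← MvPolynomial.totalDegree_zero_iff_isHomogeneous,
    MvPolynomial.totalDegree_eq_zero_iff_eq_C] at hp
  refine ⟨p.coeff 0, ?_⟩
  rw [hp]
  ext x
  simp

theorem const_mem_sphericalHarmonics_zero (d : ℕ) (c : ℝ) :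
    ContinuousMap.const _ c ∈ sphericalHarmonics d 0 :=
  mem_sphericalHarmonics_iff.2 ⟨MvPolynomial.C c, MvPolynomial.isHomogeneous_C _ _,
    polyLaplacian_eq_zero_of_isHomogeneous two_pos (MvPolynomial.isHomogeneous_C _ _), by
      ext x; simp⟩

/-- The linear form of a row of the matrix of a linear isometry. -/
noncomputable def isometryForm {d : ℕ}
    (R : EuclideanSpace ℝ (Fin (d + 1)) ≃ₗᵢ[ℝ] EuclideanSpace ℝ (Fin (d + 1)))
    (k : Fin (d + 1)) : MvPolynomial (Fin (d + 1)) ℝ :=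
  ∑ m, MvPolynomial.C (R (EuclideanSpace.single m 1) k) * MvPolynomial.X m

theorem pderiv_isometryForm {d : ℕ}
    (R : EuclideanSpace ℝ (Fin (d + 1)) ≃ₗᵢ[ℝ] EuclideanSpace ℝ (Fin (d + 1)))
    (i k : Fin (d + 1)) : MvPolynomial.pderiv i (isometryForm R k) =
      MvPolynomial.C (R (EuclideanSpace.single i 1) k) := by
  classical
  simp only [isometryForm, map_sum, MvPolynomial.pderiv_C_mul, MvPolynomial.pderiv_X]
  rw [Finset.sum_eq_single i] <;> simp +contextual

theorem sum_isometry_mul {d : ℕ}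
    (R : EuclideanSpace ℝ (Fin (d + 1)) ≃ₗᵢ[ℝ] EuclideanSpace ℝ (Fin (d + 1)))
    (j k : Fin (d + 1)) :
    ∑ i, R (EuclideanSpace.single i 1) j * R (EuclideanSpace.single i 1) k =
      if j = k then 1 else 0 := by
  have h : ∀ i j, R (EuclideanSpace.single i 1) j = R.symm (EuclideanSpace.single j 1) i := by
    intro i j
    have := R.inner_map_map (EuclideanSpace.single i 1) (R.symm (EuclideanSpace.single j 1))
    simpa [EuclideanSpace.inner_single_left, EuclideanSpace.inner_single_right] using this
  have := R.symm.inner_map_map (EuclideanSpace.single k 1) (EuclideanSpace.single j 1)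
  rw [PiLp.inner_apply] at this
  simp only [h]
  simpa [EuclideanSpace.inner_single_left, Pi.single_apply, eq_comm] using this

theorem pderiv_aeval_isometryForm {d : ℕ}
    (R : EuclideanSpace ℝ (Fin (d + 1)) ≃ₗᵢ[ℝ] EuclideanSpace ℝ (Fin (d + 1)))
    (i : Fin (d + 1)) (p : MvPolynomial (Fin (d + 1)) ℝ) :
    MvPolynomial.pderiv i (MvPolynomial.aeval (isometryForm R) p) =
      ∑ k, MvPolynomial.C (R (EuclideanSpace.single i 1) k) *
        MvPolynomial.aeval (isometryForm R) (MvPolynomial.pderiv k p) := by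
  classical
  induction p using MvPolynomial.induction_on with
  | C a => simp [MvPolynomial.algebraMap_eq]
  | add p q hp hq => simp only [map_add, hp, hq, mul_add, Finset.sum_add_distrib]
  | mul_X p j hp =>
    simp only [map_mul, MvPolynomial.aeval_X, MvPolynomial.pderiv_mul, hp, map_add,
      pderiv_isometryForm, MvPolynomial.pderiv_X, mul_add, Finset.sum_add_distrib, Finset.sum_mul,
      mul_assoc]
    congr 1
    rw [Finset.sum_eq_single j]
    · simp [mul_comm]
    · intro b _ hb
      simp [hb.symm]
    · simp

theorem polyLaplacian_aeval_isometryForm {d : ℕ}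
    (R : EuclideanSpace ℝ (Fin (d + 1)) ≃ₗᵢ[ℝ] EuclideanSpace ℝ (Fin (d + 1)))
    (p : MvPolynomial (Fin (d + 1)) ℝ) :
    polyLaplacian d (MvPolynomial.aeval (isometryForm R) p) =
      MvPolynomial.aeval (isometryForm R) (polyLaplacian d p) := by
  simp only [polyLaplacian_apply, pderiv_aeval_isometryForm, map_sum, MvPolynomial.pderiv_C_mul,
    Finset.mul_sum]
  rw [Finset.sum_comm]
  refine Finset.sum_congr rfl fun j _ => ?_
  rw [Finset.sum_comm]
  simp only [← mul_assoc, ← MvPolynomial.C_mul, ← Finset.sum_mul, ← map_sum, sum_isometry_mul]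
  rw [Finset.sum_eq_single j] <;> simp +contextual [eq_comm]

theorem comp_sphereMap_mem_sphericalHarmonics {d ℓ : ℕ} {Y : C(USphere d, ℝ)}
    (R : EuclideanSpace ℝ (Fin (d + 1)) ≃ₗᵢ[ℝ] EuclideanSpace ℝ (Fin (d + 1)))
    (hY : Y ∈ sphericalHarmonics d ℓ) : Y.comp (sphereMap R) ∈ sphericalHarmonics d ℓ := by
  obtain ⟨p, hp, hp0, rfl⟩ := mem_sphericalHarmonics_iff.1 hY
  refine mem_sphericalHarmonics_iff.2 ⟨MvPolynomial.aeval (isometryForm R) p, ?_, ?_, ?_⟩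
  · have := hp.aeval (isometryForm R) (n := 1) fun k => MvPolynomial.IsHomogeneous.sum _ _ _
      fun m _ => MvPolynomial.isHomogeneous_C_mul_X _ _
    rwa [one_mul] at this
  · rw [polyLaplacian_aeval_isometryForm, hp0, map_zero]
  · rw [sphereEval_comp_sphereMap, sphereEval, ← AlgHom.comp_apply]
    congr 1
    refine MvPolynomial.algHom_ext fun k => ?_
    simp only [AlgHom.comp_apply, MvPolynomial.aeval_X, isometryForm]
    ext x
    simp only [map_sum, map_mul, MvPolynomial.aeval_X, ContinuousMap.comp_apply]
    change _ = R x.1 k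
    have hx : x.1 = ∑ m, x.1 m • EuclideanSpace.single m (1 : ℝ) := by
      ext k
      simp [Pi.single_apply]
    conv_rhs => rw [hx]
    simp [MvPolynomial.algHom_C, sphereCoord, mul_comm]

theorem exists_sphereMap_eq {d : ℕ} (x y : USphere d) :
    ∃ R : EuclideanSpace ℝ (Fin (d + 1)) ≃ₗᵢ[ℝ] EuclideanSpace ℝ (Fin (d + 1)),
      sphereMap R x = y :=
  ⟨_, Subtype.ext (Submodule.reflection_sub (v := x.1) (w := y.1) (by simp))⟩

namespace IsHarmonicBasis

variable {d : ℕ} {Y : (ℓ : ℕ) → Fin (harmonicDim d ℓ) → C(USphere d, ℝ)}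

theorem mem (hY : IsHarmonicBasis d Y) (ℓ : ℕ) (k : Fin (harmonicDim d ℓ)) :
    Y ℓ k ∈ sphericalHarmonics d ℓ := by
  rw [← hY.span_eq ℓ]
  exact Submodule.subset_span ⟨k, rfl⟩

theorem sphereIntegral_mul (hY : IsHarmonicBasis d Y) (ℓ : ℕ) (j k : Fin (harmonicDim d ℓ)) :
    sphereIntegral d (Y ℓ j * Y ℓ k) = if j = k then 1 else 0 :=
  hY.orthonormal ℓ j k

theorem lfCoeff_sum_self (hY : IsHarmonicBasis d Y) (ℓ : ℕ) (c : Fin (harmonicDim d ℓ) → ℝ)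
    (j : Fin (harmonicDim d ℓ)) : lfCoeff (∑ k, c k • Y ℓ k) (Y ℓ j) = c j := by
  rw [lfCoeff_eq_sphereIntegralMul]
  simp [sphereIntegralMul_apply, hY.sphereIntegral_mul]

theorem lfCoeff_of_ne (hY : IsHarmonicBasis d Y) (hd : 2 ≤ d) {ℓ m : ℕ} (hne : ℓ ≠ m)
    {f : C(USphere d, ℝ)} (hf : f ∈ sphericalHarmonics d ℓ) (j : Fin (harmonicDim d m)) :
    lfCoeff f (Y m j) = 0 := by
  rw [lfCoeff_eq_sphereIntegral]
  exact sphereIntegral_mul_eq_zero hd hne hf (hY.mem m j)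

theorem eq_sum_lfCoeff (hY : IsHarmonicBasis d Y) {ℓ : ℕ} {f : C(USphere d, ℝ)}
    (hf : f ∈ sphericalHarmonics d ℓ) : f = ∑ k, lfCoeff f (Y ℓ k) • Y ℓ k := by
  rw [← hY.span_eq ℓ, Submodule.mem_span_range_iff_exists_fun] at hf
  obtain ⟨c, rfl⟩ := hf
  simp only [hY.lfCoeff_sum_self]

theorem sphereIntegral_mul_self (hY : IsHarmonicBasis d Y) {ℓ : ℕ} {f : C(USphere d, ℝ)}
    (hf : f ∈ sphericalHarmonics d ℓ) :
    sphereIntegral d (f * f) = ∑ k, lfCoeff f (Y ℓ k) ^ 2 := by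
  conv_lhs => rw [hY.eq_sum_lfCoeff hf, Finset.mul_sum, map_sum]
  refine Finset.sum_congr rfl fun k _ => ?_
  rw [← hY.eq_sum_lfCoeff hf, mul_smul_comm, map_smul, lfCoeff_eq_sphereIntegral, smul_eq_mul,
    sq]

theorem sum_sq_le (hY : IsHarmonicBasis d Y) (ℓ : ℕ) (x y : USphere d) :
    ∑ k, Y ℓ k x ^ 2 ≤ ∑ k, Y ℓ k y ^ 2 := by
  obtain ⟨R, hR⟩ := exists_sphereMap_eq y x
  set g : C(USphere d, ℝ) := ∑ k, Y ℓ k x • Y ℓ k with hg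
  have hgmem : g ∈ sphericalHarmonics d ℓ :=
    sum_mem fun k _ => Submodule.smul_mem _ _ (hY.mem ℓ k)
  have hmem := comp_sphereMap_mem_sphericalHarmonics R hgmem
  have h1 : sphereIntegral d (g.comp (sphereMap R) * g.comp (sphereMap R)) =
      ∑ k, Y ℓ k x ^ 2 := by
    rw [← ContinuousMap.mul_comp, sphereIntegral_comp, hY.sphereIntegral_mul_self hgmem]
    simp only [hg, hY.lfCoeff_sum_self]
  have h2 : g.comp (sphereMap R) y = ∑ k, Y ℓ k x ^ 2 := by
    simp [hR, hg, ContinuousMap.sum_apply, sq]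
  have h3 := DFunLike.congr_fun (hY.eq_sum_lfCoeff hmem) y
  rw [hY.sphereIntegral_mul_self hmem] at h1
  rw [h2, ContinuousMap.sum_apply] at h3
  simp only [ContinuousMap.smul_apply, smul_eq_mul] at h3
  have h4 := Finset.sum_mul_sq_le_sq_mul_sq Finset.univ
    (fun k => lfCoeff (g.comp (sphereMap R)) (Y ℓ k)) (fun k => Y ℓ k y)
  rw [← h3, h1] at h4
  have h5 : 0 ≤ ∑ k, Y ℓ k x ^ 2 := Finset.sum_nonneg fun _ _ => sq_nonneg _
  have h6 : 0 ≤ ∑ k, Y ℓ k y ^ 2 := Finset.sum_nonneg fun _ _ => sq_nonneg _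
  nlinarith

/-- The addition theorem on the diagonal. -/
theorem sum_sq_eq (hY : IsHarmonicBasis d Y) (ℓ : ℕ) (x : USphere d) :
    ∑ k, Y ℓ k x ^ 2 = harmonicDim d ℓ := by
  have h1 : ∑ k, Y ℓ k * Y ℓ k = ContinuousMap.const _ (∑ k, Y ℓ k x ^ 2) := by
    ext y
    rw [ContinuousMap.sum_apply]
    simp only [← sq]
    exact le_antisymm (hY.sum_sq_le ℓ y x) (hY.sum_sq_le ℓ x y)
  have h2 := congrArg (sphereIntegral d) h1
  rw [map_sum] at h2
  simp only [hY.sphereIntegral_mul, if_true] at h2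
  simpa [sphereIntegral_apply] using h2.symm

theorem lfCoeff_sum (hY : IsHarmonicBasis d Y) (hd : 2 ≤ d) (s : Finset ℕ)
    (c : (ℓ : ℕ) → Fin (harmonicDim d ℓ) → ℝ) (m : ℕ) (j : Fin (harmonicDim d m)) :
    lfCoeff (∑ ℓ ∈ s, ∑ k, c ℓ k • Y ℓ k) (Y m j) = if m ∈ s then c m j else 0 := by
  rw [lfCoeff_eq_sphereIntegralMul, map_sum]
  simp only [← lfCoeff_eq_sphereIntegralMul]
  have h : ∀ ℓ, ℓ ≠ m → lfCoeff (∑ k, c ℓ k • Y ℓ k) (Y m j) = 0 := fun ℓ hℓ =>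
    hY.lfCoeff_of_ne hd hℓ (sum_mem fun k _ => Submodule.smul_mem _ _ (hY.mem ℓ k)) j
  split_ifs with hm
  · rw [Finset.sum_eq_single m (fun ℓ _ hℓ => h ℓ hℓ) fun hm' => absurd hm hm',
      hY.lfCoeff_sum_self]
  · exact Finset.sum_eq_zero fun ℓ hℓ => h ℓ fun hlm => hm (hlm ▸ hℓ)

end IsHarmonicBasis

theorem IsSobolevWeight.summable_mul_harmonicDim {d : ℕ} (hd : 2 ≤ d) {s : ℝ}
    (hs : (d : ℝ) / 2 < s) {a : ℕ → ℝ} (ha : IsSobolevWeight d s a) :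
    Summable fun ℓ => a ℓ * (harmonicDim d ℓ : ℝ) := by
  obtain ⟨hpos, c₁, c₂, hc₁, hc₂, hle⟩ := ha
  have hd' : (2 : ℝ) ≤ d := by exact_mod_cast hd
  have hsum : Summable fun ℓ : ℕ => ((ℓ : ℝ) + 1) ^ (((d - 1 : ℕ) : ℝ) - 2 * s) := by
    have := (summable_nat_add_iff 1).2
      (Real.summable_nat_rpow (p := ((d - 1 : ℕ) : ℝ) - 2 * s) |>.2 (by
        rw [Nat.cast_sub (by omega)]; push_cast; linarith))
    simpa using this
  refine Summable.of_nonneg_of_le (fun ℓ => mul_nonneg (hpos ℓ).le (Nat.cast_nonneg _))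
    (fun ℓ => ?_) (hsum.mul_left (c₂ * (2 ^ s * 2)))
  have hℓ : (0 : ℝ) < (ℓ : ℝ) + 1 := by positivity
  have hZ : (harmonicDim d ℓ : ℝ) ≤ 2 * ((ℓ : ℝ) + 1) ^ ((d - 1 : ℕ) : ℝ) := by
    rw [Real.rpow_natCast]
    exact_mod_cast harmonicDim_le hd ℓ
  have hlow : ((ℓ : ℝ) + 1) ^ 2 / 2 ≤ 1 + sphereEigenvalue d ℓ := by
    rw [sphereEigenvalue]
    nlinarith [(Nat.cast_nonneg ℓ : (0 : ℝ) ≤ ℓ)]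
  have hpow : (1 + sphereEigenvalue d ℓ) ^ (-s) ≤ 2 ^ s * ((ℓ : ℝ) + 1) ^ (-(2 * s)) := by
    refine (Real.rpow_le_rpow_of_nonpos (by positivity) hlow (by linarith)).trans (le_of_eq ?_)
    rw [Real.div_rpow (by positivity) (by positivity), ← Real.rpow_natCast, ← Real.rpow_mul hℓ.le,
      Real.rpow_neg two_pos.le s, div_inv_eq_mul, mul_comm]
    push_cast
    rw [mul_neg]
  calc a ℓ * (harmonicDim d ℓ : ℝ)
      ≤ (c₂ * (2 ^ s * ((ℓ : ℝ) + 1) ^ (-(2 * s)))) *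
          (2 * ((ℓ : ℝ) + 1) ^ ((d - 1 : ℕ) : ℝ)) := by
        refine mul_le_mul ((hle ℓ).2.trans ?_) hZ (Nat.cast_nonneg _) (by positivity)
        exact mul_le_mul_of_nonneg_left hpow hc₂.le
    _ = c₂ * (2 ^ s * 2) * ((ℓ : ℝ) + 1) ^ (((d - 1 : ℕ) : ℝ) - 2 * s) := by
        rw [sub_eq_add_neg, Real.rpow_add hℓ]
        ring

section Expansion

variable {d : ℕ} {Y : (ℓ : ℕ) → Fin (harmonicDim d ℓ) → C(USphere d, ℝ)}

theorem norm_sum_smul_le (hY : IsHarmonicBasis d Y) (ℓ : ℕ) {α : ℝ} (hα : 0 < α)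
    (c : Fin (harmonicDim d ℓ) → ℝ) :
    ‖∑ k, c k • Y ℓ k‖ ≤ (∑ k, 1 / α * c k ^ 2) + α * harmonicDim d ℓ := by
  have hnn : 0 ≤ ∑ k, 1 / α * c k ^ 2 := Finset.sum_nonneg fun k _ => by positivity
  rw [ContinuousMap.norm_le _ (by positivity)]
  intro x
  rw [← hY.sum_sq_eq ℓ x, Real.norm_eq_abs, ContinuousMap.sum_apply, Finset.mul_sum,
    ← Finset.sum_add_distrib]
  refine (Finset.abs_sum_le_sum_abs _ _).trans (Finset.sum_le_sum fun k _ => ?_)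
  rw [ContinuousMap.smul_apply, smul_eq_mul]
  have h1 : 1 / α * c k ^ 2 + α * Y ℓ k x ^ 2 - 2 * (c k * Y ℓ k x) =
      α * (c k / α - Y ℓ k x) ^ 2 := by field_simp; ring
  have h2 : 1 / α * c k ^ 2 + α * Y ℓ k x ^ 2 + 2 * (c k * Y ℓ k x) =
      α * (c k / α + Y ℓ k x) ^ 2 := by field_simp; ring
  have h3 : 0 ≤ α * (c k / α - Y ℓ k x) ^ 2 := by positivity
  have h4 : 0 ≤ α * (c k / α + Y ℓ k x) ^ 2 := by positivity
  have h5 : 0 ≤ 1 / α * c k ^ 2 + α * Y ℓ k x ^ 2 := by positivity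
  rw [abs_le]
  constructor <;> linarith

theorem tsum_le_one_of_sobolevNorm_le_one {a : ℕ → ℝ} {f : C(USphere d, ℝ)}
    (hf : sobolevNorm a Y f ≤ 1) :
    ∑' ℓ, ∑ k, ENNReal.ofReal (1 / a ℓ * lfCoeff f (Y ℓ k) ^ 2) ≤ 1 := by
  rw [sobolevNorm] at hf
  by_contra! h
  exact absurd hf (not_le.2 (ENNReal.one_lt_rpow h (by norm_num)))

theorem sum_le_one_of_sobolevNorm_le_one {a : ℕ → ℝ} (ha : ∀ ℓ, 0 < a ℓ) {f : C(USphere d, ℝ)}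
    (hf : sobolevNorm a Y f ≤ 1) (s : Finset ℕ) :
    ∑ ℓ ∈ s, ∑ k, 1 / a ℓ * lfCoeff f (Y ℓ k) ^ 2 ≤ 1 := by
  have hnn : ∀ ℓ k, 0 ≤ 1 / a ℓ * lfCoeff f (Y ℓ k) ^ 2 := fun ℓ k =>
    mul_nonneg (one_div_nonneg.2 (ha ℓ).le) (sq_nonneg _)
  have h := (ENNReal.sum_le_tsum s).trans (tsum_le_one_of_sobolevNorm_le_one hf)
  simp only [← ENNReal.ofReal_sum_of_nonneg fun k _ => hnn _ k] at h
  rw [← ENNReal.ofReal_sum_of_nonneg fun ℓ _ => Finset.sum_nonneg fun k _ => hnn ℓ k] at h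
  exact ENNReal.ofReal_le_one.1 h

/-- The Laplace series of a function in the Sobolev unit ball converges uniformly to it. -/
theorem hasSum_laplaceSeries (hd : 2 ≤ d) (hY : IsHarmonicBasis d Y) {a : ℕ → ℝ}
    (ha : ∀ ℓ, 0 < a ℓ) (hsum : Summable fun ℓ => a ℓ * (harmonicDim d ℓ : ℝ))
    {f : C(USphere d, ℝ)} (hf : sobolevNorm a Y f ≤ 1) :
    HasSum (fun ℓ => ∑ k, lfCoeff f (Y ℓ k) • Y ℓ k) f := by
  have hq : Summable fun ℓ => ∑ k, 1 / a ℓ * lfCoeff f (Y ℓ k) ^ 2 :=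
    summable_of_sum_le (fun ℓ => Finset.sum_nonneg fun k _ =>
      mul_nonneg (one_div_nonneg.2 (ha ℓ).le) (sq_nonneg _))
      (sum_le_one_of_sobolevNorm_le_one ha hf)
  have hs : Summable fun ℓ => ∑ k, lfCoeff f (Y ℓ k) • Y ℓ k :=
    Summable.of_norm_bounded (hq.add hsum) fun ℓ => norm_sum_smul_le hY ℓ (ha ℓ) _
  obtain ⟨g, hg⟩ := hs
  have hcoeff : ∀ m j, lfCoeff g (Y m j) = lfCoeff f (Y m j) := by
    intro m j
    have h1 := hg.mapL (sphereIntegralMul (Y m j))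
    have h2 : HasSum (fun ℓ => sphereIntegralMul (Y m j) (∑ k, lfCoeff f (Y ℓ k) • Y ℓ k))
        (lfCoeff f (Y m j)) := by
      have h3 := hasSum_single (f := fun ℓ =>
        sphereIntegralMul (Y m j) (∑ k, lfCoeff f (Y ℓ k) • Y ℓ k)) m fun ℓ hℓ => by
          rw [← lfCoeff_eq_sphereIntegralMul]
          exact hY.lfCoeff_of_ne hd hℓ
            (sum_mem fun k _ => Submodule.smul_mem _ _ (hY.mem ℓ k)) j
      rwa [← lfCoeff_eq_sphereIntegralMul, hY.lfCoeff_sum_self] at h3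
    rw [lfCoeff_eq_sphereIntegralMul]
    exact h1.unique h2
  have h0 : f - g = 0 := by
    refine eq_zero_of_forall_sphereIntegral_mul hd fun ℓ Z hZ => ?_
    rw [← hY.span_eq ℓ, Submodule.mem_span_range_iff_exists_fun] at hZ
    obtain ⟨c, rfl⟩ := hZ
    rw [Finset.mul_sum, map_sum]
    refine Finset.sum_eq_zero fun k _ => ?_
    rw [mul_smul_comm, map_smul, sub_mul, map_sub, ← lfCoeff_eq_sphereIntegral,
      ← lfCoeff_eq_sphereIntegral, hcoeff, sub_self, smul_zero]
  rwa [← sub_eq_zero.1 h0] at hg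

/-- The squared norm of a continuous linear functional on the Sobolev space. -/
theorem iSup_sobolev_sq (hd : 2 ≤ d) (hY : IsHarmonicBasis d Y) {a : ℕ → ℝ}
    (ha : ∀ ℓ, 0 < a ℓ) (hsum : Summable fun ℓ => a ℓ * (harmonicDim d ℓ : ℝ)) (s : ℝ)
    (e : C(USphere d, ℝ) →L[ℝ] ℝ) :
    (⨆ (f : C(USphere d, ℝ)) (_ : MemSobolev s Y f) (_ : sobolevNorm a Y f ≤ 1),
      ENNReal.ofReal |e f|) ^ 2 = ∑' ℓ, ∑ k, ENNReal.ofReal (a ℓ * e (Y ℓ k) ^ 2) := by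
  have hnn : ∀ ℓ k, 0 ≤ a ℓ * e (Y ℓ k) ^ 2 := fun ℓ k => mul_nonneg (ha ℓ).le (sq_nonneg _)
  have hofReal : ∀ t : Finset ℕ, ∑ ℓ ∈ t, ∑ k, ENNReal.ofReal (a ℓ * e (Y ℓ k) ^ 2) =
      ENNReal.ofReal (∑ ℓ ∈ t, ∑ k, a ℓ * e (Y ℓ k) ^ 2) := fun t => by
    simp only [← ENNReal.ofReal_sum_of_nonneg fun k _ => hnn _ k]
    rw [ENNReal.ofReal_sum_of_nonneg fun ℓ _ => Finset.sum_nonneg fun k _ => hnn ℓ k]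
  have habs : ∀ r : ℝ, ENNReal.ofReal |r| ^ 2 = ENNReal.ofReal (r ^ 2) := fun r => by
    rw [← ENNReal.ofReal_pow (abs_nonneg _), sq_abs]
  apply le_antisymm
  · set W := ∑' ℓ, ∑ k, ENNReal.ofReal (a ℓ * e (Y ℓ k) ^ 2) with hW
    have hW2 : W = (W ^ (1 / 2 : ℝ)) ^ 2 := by
      rw [← ENNReal.rpow_natCast, ← ENNReal.rpow_mul]; norm_num
    rw [hW2]
    refine pow_le_pow_left' (iSup_le fun f => iSup_le fun _ => iSup_le fun hf => ?_) 2
    rw [← ENNReal.pow_le_pow_left_iff two_ne_zero, ← hW2, habs]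
    have hlim := (hasSum_laplaceSeries hd hY ha hsum hf).mapL e
    refine le_of_tendsto ((ENNReal.continuous_ofReal.tendsto _).comp (hlim.pow 2))
      (.of_forall fun t => ?_)
    refine le_trans ?_ (ENNReal.sum_le_tsum t)
    rw [hofReal]
    refine ENNReal.ofReal_le_ofReal ?_
    have hcs := Finset.sum_sq_le_sum_mul_sum_of_sq_le_mul
      (t.sigma fun ℓ => (Finset.univ : Finset (Fin (harmonicDim d ℓ))))
      (r := fun p => lfCoeff f (Y p.1 p.2) * e (Y p.1 p.2))
      (f := fun p => 1 / a p.1 * lfCoeff f (Y p.1 p.2) ^ 2)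
      (g := fun p => a p.1 * e (Y p.1 p.2) ^ 2)
      (fun p _ => mul_nonneg (one_div_nonneg.2 (ha _).le) (sq_nonneg _))
      (fun p _ => hnn _ _) (fun p _ => by have := (ha p.1).ne'; exact le_of_eq (by field_simp))
    simp only [Finset.sum_sigma] at hcs
    simp only [map_sum, map_smul, smul_eq_mul]
    refine hcs.trans (mul_le_of_le_one_left ?_ (sum_le_one_of_sobolevNorm_le_one ha hf t))
    exact Finset.sum_nonneg fun ℓ _ => Finset.sum_nonneg fun k _ => hnn ℓ k
  · rw [ENNReal.tsum_eq_iSup_sum]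
    refine iSup_le fun t => ?_
    rw [hofReal]
    set w := ∑ ℓ ∈ t, ∑ k, a ℓ * e (Y ℓ k) ^ 2 with hw
    rcases le_or_gt w 0 with hw0 | hw0
    · rw [ENNReal.ofReal_of_nonpos hw0]; exact zero_le
    set c : (ℓ : ℕ) → Fin (harmonicDim d ℓ) → ℝ := fun ℓ k => a ℓ * e (Y ℓ k) / √w with hc
    set f : C(USphere d, ℝ) := ∑ ℓ ∈ t, ∑ k, c ℓ k • Y ℓ k with hf
    have hcoef := fun m j => hY.lfCoeff_sum hd t c m j
    rw [← hf] at hcoef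
    have hsw : √w ^ 2 = w := Real.sq_sqrt hw0.le
    have hsw0 : 0 < √w := Real.sqrt_pos.2 hw0
    have hterm : ∀ ℓ k, 1 / a ℓ * c ℓ k ^ 2 = a ℓ * e (Y ℓ k) ^ 2 / w := by
      intro ℓ k
      rw [hc]
      have := (ha ℓ).ne'
      simp only [div_pow, hsw]
      field_simp
    have hef : e f = √w := by
      have : e f = w / √w := by
        rw [hf, hw, Finset.sum_div]
        simp only [map_sum, map_smul, smul_eq_mul, hc, Finset.sum_div]
        exact Finset.sum_congr rfl fun ℓ _ => Finset.sum_congr rfl fun k _ => by ring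
      rw [this, div_eq_iff hsw0.ne', ← sq, hsw]
    have hmem : MemSobolev s Y f := by
      rw [MemSobolev, tsum_eq_sum (s := t)]
      · exact ENNReal.sum_lt_top.2 fun ℓ _ => ENNReal.sum_lt_top.2 fun k _ => ENNReal.ofReal_lt_top
      · intro ℓ hℓ
        simp [hcoef, hℓ]
    have hnorm : sobolevNorm a Y f ≤ 1 := by
      rw [sobolevNorm, tsum_eq_sum (s := t)]
      · have : ∑ ℓ ∈ t, ∑ k, ENNReal.ofReal (1 / a ℓ * lfCoeff f (Y ℓ k) ^ 2) =
            ENNReal.ofReal (∑ ℓ ∈ t, ∑ k, a ℓ * e (Y ℓ k) ^ 2 / w) := by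
          rw [ENNReal.ofReal_sum_of_nonneg fun ℓ _ => Finset.sum_nonneg fun k _ =>
            div_nonneg (hnn ℓ k) hw0.le]
          refine Finset.sum_congr rfl fun ℓ hℓ => ?_
          rw [ENNReal.ofReal_sum_of_nonneg fun k _ => div_nonneg (hnn ℓ k) hw0.le]
          simp only [hcoef, hℓ, if_true, hterm]
        rw [this]
        simp only [← Finset.sum_div]
        rw [← hw, div_self hw0.ne', ENNReal.ofReal_one, ENNReal.one_rpow]
      · intro ℓ hℓ
        simp [hcoef, hℓ]
    calc ENNReal.ofReal w = ENNReal.ofReal |e f| ^ 2 := by rw [habs, hef, hsw]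
      _ ≤ _ := pow_le_pow_left' (le_iSup_of_le f (le_iSup_of_le hmem
        (le_iSup (fun _ : sobolevNorm a Y f ≤ 1 => ENNReal.ofReal |e f|) hnorm))) 2

end Expansion

/-- The error of the equal weight quadrature rule with nodes `x`. -/
noncomputable def quadratureError {d N : ℕ} (x : Fin N → USphere d) : C(USphere d, ℝ) →L[ℝ] ℝ :=
  (1 / (N : ℝ)) • ∑ j, ContinuousMap.evalCLM ℝ (x j) - sphereIntegral d

theorem quadratureError_apply {d N : ℕ} (x : Fin N → USphere d) (f : C(USphere d, ℝ)) :
    quadratureError x f = (1 / (N : ℝ)) * ∑ j, f (x j) - sphereIntegral d f := by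
  simp [quadratureError]

theorem continuous_quadratureError {d N : ℕ} (f : C(USphere d, ℝ)) :
    Continuous fun x : Fin N → USphere d => quadratureError x f := by
  simp only [quadratureError_apply]
  fun_prop

theorem worstCaseError_sq {d : ℕ} (hd : 2 ≤ d) {s : ℝ} (hs : (d : ℝ) / 2 < s) {a : ℕ → ℝ}
    (ha : IsSobolevWeight d s a) {Y : (ℓ : ℕ) → Fin (harmonicDim d ℓ) → C(USphere d, ℝ)}
    (hY : IsHarmonicBasis d Y) {N : ℕ} (x : Fin N → USphere d) :
    worstCaseError s a Y x ^ 2 =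
      ∑' ℓ, ∑ k, ENNReal.ofReal (a ℓ * quadratureError x (Y ℓ k) ^ 2) := by
  rw [← iSup_sobolev_sq hd hY ha.1 (ha.summable_mul_harmonicDim hd hs) s (quadratureError x)]
  simp only [worstCaseError, quadratureError_apply, sphereIntegral_apply]

theorem measurable_worstCaseError {d : ℕ} (hd : 2 ≤ d) {s : ℝ} (hs : (d : ℝ) / 2 < s) {a : ℕ → ℝ}
    (ha : IsSobolevWeight d s a) {Y : (ℓ : ℕ) → Fin (harmonicDim d ℓ) → C(USphere d, ℝ)}
    (hY : IsHarmonicBasis d Y) (N : ℕ) :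
    Measurable fun x : Fin N → USphere d => worstCaseError s a Y x := by
  have h : (fun x : Fin N → USphere d => worstCaseError s a Y x) = fun x =>
      (∑' ℓ, ∑ k, ENNReal.ofReal (a ℓ * quadratureError x (Y ℓ k) ^ 2)) ^ (1 / 2 : ℝ) := by
    funext x
    rw [← worstCaseError_sq hd hs ha hY, ← ENNReal.rpow_natCast, ← ENNReal.rpow_mul]
    norm_num
  rw [h]
  refine (Measurable.tsum fun ℓ => Finset.measurable_fun_sum _ fun k _ => ?_).pow_const _
  exact (((continuous_quadratureError (Y ℓ k)).pow 2).const_mul (a ℓ)).measurable.ennreal_ofReal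

theorem IsIIDUniform.hasLaw {d N : ℕ} {Ω : Type u} [MeasurableSpace Ω] {P : Measure Ω}
    [IsProbabilityMeasure P] {x : Fin N → Ω → USphere d} (hx : IsIIDUniform P x) :
    HasLaw (fun ω j => x j ω) (Measure.pi fun _ : Fin N => sphereMeasure d) P where
  aemeasurable := aemeasurable_pi_lambda _ fun j => (hx.1 j).aemeasurable
  map_eq := by
    rw [(iIndepFun_iff_map_fun_eq_pi_map fun j => (hx.1 j).aemeasurable).1 hx.2]
    simp only [(hx.1 _).map_eq]

theorem integral_sq_quadratureError {d N : ℕ} (hN : 1 ≤ N) {f : C(USphere d, ℝ)}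
    (hf : sphereIntegral d f = 0) (hf2 : sphereIntegral d (f * f) = 1) :
    ∫ x, quadratureError x f ^ 2 ∂(Measure.pi fun _ : Fin N => sphereMeasure d) = 1 / N := by
  have hN' : (N : ℝ) ≠ 0 := by positivity
  have hmem : MemLp f 2 (sphereMeasure d) :=
    (memLp_two_iff_integrable_sq f.continuous.aestronglyMeasurable).2 (integrable_sphere (f ^ 2))
  have hvar : Var[f; sphereMeasure d] = 1 := by
    rw [variance_of_integral_eq_zero f.continuous.measurable.aemeasurable hf]
    exact (integral_congr_ae (.of_forall fun x => sq (f x))).trans hf2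
  have hsum := variance_sum_pi (μ := fun _ : Fin N => sphereMeasure d) (X := fun _ => f)
    fun _ => hmem
  simp only [hvar, Finset.sum_const, Finset.card_univ, Fintype.card_fin, nsmul_eq_mul,
    mul_one] at hsum
  have hmean : ∫ x, (∑ j : Fin N, fun y : Fin N → USphere d => f (y j)) x
      ∂(Measure.pi fun _ : Fin N => sphereMeasure d) = 0 := by
    simp only [Finset.sum_apply]
    rw [integral_finsetSum]
    · refine Finset.sum_eq_zero fun j _ => ?_
      rw [← hf, sphereIntegral_apply]
      have h := measurePreserving_eval (fun _ : Fin N => sphereMeasure d) j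
      conv_rhs => rw [← h.map_eq]
      exact (integral_map h.measurable.aemeasurable f.continuous.aestronglyMeasurable).symm
    · exact fun j _ => (measurePreserving_eval (fun _ : Fin N => sphereMeasure d) j
        ).integrable_comp_of_integrable (integrable_sphere f)
  rw [variance_of_integral_eq_zero (Measurable.aemeasurable (by fun_prop)) hmean] at hsum
  simp only [quadratureError_apply, hf, sub_zero, mul_pow]
  rw [integral_const_mul]
  simp only [Finset.sum_apply] at hsum
  rw [hsum]
  field_simp

theorem integrable_sq_quadratureError {d N : ℕ} (f : C(USphere d, ℝ)) :
    Integrable (fun x => quadratureError x f ^ 2)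
      (Measure.pi fun _ : Fin N => sphereMeasure d) :=
  ((continuous_quadratureError f).pow 2).integrable_of_hasCompactSupport
    (HasCompactSupport.of_compactSpace _)

namespace IsHarmonicBasis

variable {d : ℕ} {Y : (ℓ : ℕ) → Fin (harmonicDim d ℓ) → C(USphere d, ℝ)}

theorem sphereIntegral_eq_zero (hY : IsHarmonicBasis d Y) (hd : 2 ≤ d) {ℓ : ℕ} (hℓ : ℓ ≠ 0)
    (k : Fin (harmonicDim d ℓ)) : sphereIntegral d (Y ℓ k) = 0 := by
  rw [← mul_one (Y ℓ k)]
  exact sphereIntegral_mul_eq_zero hd hℓ (hY.mem ℓ k) (const_mem_sphericalHarmonics_zero d 1)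

theorem quadratureError_zero (hY : IsHarmonicBasis d Y) {N : ℕ} (hN : 1 ≤ N)
    (x : Fin N → USphere d) (k : Fin (harmonicDim d 0)) : quadratureError x (Y 0 k) = 0 := by
  obtain ⟨c, hc⟩ := exists_eq_const_of_mem_sphericalHarmonics_zero (hY.mem 0 k)
  have hN' : (N : ℝ) ≠ 0 := by positivity
  rw [hc, quadratureError_apply, sphereIntegral_apply]
  simp [hN']

end IsHarmonicBasis

/-- The mean square worst-case error of random points. -/
theorem lintegral_worstCaseError_sq {d : ℕ} (hd : 2 ≤ d) {s : ℝ} (hs : (d : ℝ) / 2 < s)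
    {a : ℕ → ℝ} (ha : IsSobolevWeight d s a)
    {Y : (ℓ : ℕ) → Fin (harmonicDim d ℓ) → C(USphere d, ℝ)}
    (hY : IsHarmonicBasis d Y) {N : ℕ} (hN : 1 ≤ N) :
    ∫⁻ x, worstCaseError s a Y x ^ 2 ∂(Measure.pi fun _ : Fin N => sphereMeasure d) =
      ENNReal.ofReal ((∑' ℓ, a (ℓ + 1) * harmonicDim d (ℓ + 1)) / N) := by
  have hterm : ∀ ℓ (k : Fin (harmonicDim d (ℓ + 1))),
      ∫⁻ x, ENNReal.ofReal (a (ℓ + 1) * quadratureError x (Y (ℓ + 1) k) ^ 2)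
        ∂(Measure.pi fun _ : Fin N => sphereMeasure d) = ENNReal.ofReal (a (ℓ + 1) / N) := by
    intro ℓ k
    rw [← ofReal_integral_eq_lintegral_ofReal ((integrable_sq_quadratureError _).const_mul _)
      (.of_forall fun x => mul_nonneg (ha.1 _).le (sq_nonneg _)), integral_const_mul,
      integral_sq_quadratureError hN (hY.sphereIntegral_eq_zero hd ℓ.succ_ne_zero k)
        (by rw [hY.sphereIntegral_mul, if_pos rfl]), mul_one_div]
  have hmeas : ∀ ℓ k, Measurable fun x : Fin N → USphere d =>
      ENNReal.ofReal (a ℓ * quadratureError x (Y ℓ k) ^ 2) := fun ℓ k =>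
    (((continuous_quadratureError (Y ℓ k)).pow 2).const_mul (a ℓ)).measurable.ennreal_ofReal
  simp only [worstCaseError_sq hd hs ha hY]
  rw [lintegral_tsum fun ℓ =>
    (Finset.measurable_fun_sum _ fun k _ => hmeas ℓ k).aemeasurable]
  rw [tsum_eq_zero_add' ENNReal.summable]
  simp only [lintegral_finsetSum _ fun k _ => hmeas _ k, hY.quadratureError_zero hN, hterm]
  have hsum := (summable_nat_add_iff 1).2 (ha.summable_mul_harmonicDim hd hs)
  rw [← tsum_div_const, ENNReal.ofReal_tsum_of_nonneg
    (fun ℓ => div_nonneg (mul_nonneg (ha.1 _).le (Nat.cast_nonneg _)) (Nat.cast_nonneg _))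
    (hsum.div_const _)]
  simp only [ne_eq, OfNat.ofNat_ne_zero, not_false_eq_true, zero_pow, mul_zero,
    ENNReal.ofReal_zero, lintegral_zero, Finset.sum_const_zero, zero_add, Finset.sum_const,
    Finset.card_univ, Fintype.card_fin, nsmul_eq_mul]
  refine tsum_congr fun ℓ => ?_
  rw [← ENNReal.ofReal_natCast, ← ENNReal.ofReal_mul (Nat.cast_nonneg _)]
  congr 1
  ring

/-- Anti-concentration of normalized sums of independent uniform samples, uniformly in the number
of samples. -/
theorem exists_eventually_measure_sum_le {d : ℕ} {f : C(USphere d, ℝ)}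
    (hf : sphereIntegral d f = 0) (hf2 : sphereIntegral d (f * f) = 1) {ε : ℝ≥0∞} (hε : 0 < ε) :
    ∃ δ : ℝ, 0 < δ ∧ ∀ᶠ N : ℕ in Filter.atTop,
      Measure.pi (fun _ : Fin N => sphereMeasure d)
        {y | |(√N)⁻¹ * ∑ j, f (y j)| ≤ δ} ≤ ε := by
  have hna : NullSingletonClass (gaussianReal 0 1) := nullSingletonClass_gaussianReal one_ne_zero
  obtain ⟨U, hU0, hUo, hUε⟩ := ({0} : Set ℝ).exists_isOpen_lt_of_lt (μ := gaussianReal 0 1) ε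
    (by rwa [measure_singleton])
  obtain ⟨δ, hδ, hball⟩ := Metric.nhds_basis_closedBall.mem_iff.1
    (hUo.mem_nhds (hU0 (Set.mem_singleton 0)))
  refine ⟨δ, hδ, ?_⟩
  obtain ⟨Ω, _, P, X, hXm, hXlaw, hXind, hP⟩ := exists_iid ℕ (sphereMeasure d)
  have hfm : Measurable f := f.continuous.measurable
  have hint : ∀ g : C(USphere d, ℝ), ∫ ω, g (X 0 ω) ∂P = sphereIntegral d g := fun g => by
    rw [sphereIntegral_apply, ← (hXlaw 0).map_eq]
    exact (integral_map (hXm 0).aemeasurable g.continuous.aestronglyMeasurable).symm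
  have hclt := tendstoInDistribution_inv_sqrt_mul_sum (P := P) (P' := gaussianReal 0 1)
    (Y := id) (X := fun n ω => f (X n ω)) .id ((hint f).trans hf)
    ((integral_congr_ae (.of_forall fun ω => sq (f (X 0 ω)))).trans ((hint (f * f)).trans hf2))
    (hXind.comp (fun _ => f) fun _ => hfm)
    fun n => IdentDistrib.comp (u := f) ⟨(hXm n).aemeasurable, (hXm 0).aemeasurable, by
      rw [(hXlaw n).map_eq, (hXlaw 0).map_eq]⟩ hfm
  have hport := ProbabilityMeasure.limsup_measure_closed_le_of_tendsto hclt.tendsto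
    (Metric.isClosed_closedBall (x := (0 : ℝ)) (ε := δ))
  simp only [ProbabilityMeasure.coe_mk, Measure.map_id] at hport
  have hlt := hport.trans_lt ((measure_mono hball).trans_lt hUε)
  filter_upwards [Filter.eventually_lt_of_limsup_lt hlt] with N hN
  refine le_of_eq_of_le ?_ hN.le
  have hlaw : HasLaw (fun ω (j : Fin N) => X j ω)
      (Measure.pi fun _ : Fin N => sphereMeasure d) P :=
    IsIIDUniform.hasLaw ⟨fun j => hXlaw j, hXind.precomp Fin.val_injective⟩
  have hset : MeasurableSet {y : Fin N → USphere d | |(√N)⁻¹ * ∑ j, f (y j)| ≤ δ} :=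
    measurableSet_le (by fun_prop) measurable_const
  rw [Measure.map_apply (by fun_prop) Metric.isClosed_closedBall.measurableSet,
    ← hlaw.measure_eq hset]
  congr 1
  ext ω
  simp [Finset.sum_range]

/-- The worst-case error is bounded below by the error for one harmonic of degree one. -/
theorem ofReal_mul_sq_le_worstCaseError_sq {d : ℕ} (hd : 2 ≤ d) {s : ℝ} (hs : (d : ℝ) / 2 < s)
    {a : ℕ → ℝ} (ha : IsSobolevWeight d s a)
    {Y : (ℓ : ℕ) → Fin (harmonicDim d ℓ) → C(USphere d, ℝ)}
    (hY : IsHarmonicBasis d Y) {N : ℕ} (x : Fin N → USphere d) (ℓ : ℕ)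
    (k : Fin (harmonicDim d ℓ)) :
    ENNReal.ofReal (a ℓ * quadratureError x (Y ℓ k) ^ 2) ≤ worstCaseError s a Y x ^ 2 := by
  rw [worstCaseError_sq hd hs ha hY]
  refine le_trans ?_ (ENNReal.le_tsum ℓ)
  exact Finset.single_le_sum (f := fun k =>
    ENNReal.ofReal (a ℓ * quadratureError x (Y ℓ k) ^ 2)) (fun _ _ => zero_le)
    (Finset.mem_univ k)

theorem measure_forall_worstCaseError_le_eq_zero {d : ℕ} (hd : 2 ≤ d) {s : ℝ}
    (hs : (d : ℝ) / 2 < s) {a : ℕ → ℝ} (ha : IsSobolevWeight d s a)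
    {Y : (ℓ : ℕ) → Fin (harmonicDim d ℓ) → C(USphere d, ℝ)} (hY : IsHarmonicBasis d Y)
    {Ω : Type u} [MeasurableSpace Ω] {P : Measure Ω} [IsProbabilityMeasure P] {I : Set ℕ}
    {X : (N : ℕ) → Fin N → Ω → USphere d} (hI : I.Infinite)
    (hX : ∀ N ∈ I, IsIIDUniform P (X N)) {c : ℝ} (hc : 0 ≤ c) :
    P {ω | ∀ N ∈ I, 1 ≤ N → worstCaseError s a Y (fun j => X N j ω) ≤
      ENNReal.ofReal (c / (N : ℝ) ^ (s / (d : ℝ)))} = 0 := by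
  set k : Fin (harmonicDim d 1) := ⟨0, harmonicDim_one_pos hd⟩
  have hf := hY.sphereIntegral_eq_zero hd one_ne_zero k
  have hf2 : sphereIntegral d (Y 1 k * Y 1 k) = 1 := by rw [hY.sphereIntegral_mul, if_pos rfl]
  have ha1 : 0 < √(a 1) := Real.sqrt_pos.2 (ha.1 1)
  have hd0 : (0 : ℝ) < d := by positivity
  have hexp : 0 < s / d - 1 / 2 := by
    rw [sub_pos, lt_div_iff₀ hd0]
    linarith
  refine le_antisymm (le_of_forall_pos_le_add fun ε hε => ?_) zero_le
  rw [zero_add]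
  obtain ⟨δ, hδ, hev⟩ := exists_eventually_measure_sum_le hf hf2 hε
  have hlim : Filter.Tendsto (fun N : ℕ => c / √(a 1) * (N : ℝ) ^ (-(s / d - 1 / 2)))
      Filter.atTop (nhds 0) := by
    simpa using ((tendsto_rpow_neg_atTop hexp).comp tendsto_natCast_atTop_atTop).const_mul
      (c / √(a 1))
  obtain ⟨N, hNI, hN, hsmall, hN1⟩ := ((Nat.frequently_atTop_iff_infinite.2 hI).and_eventually
    (hev.and ((hlim.eventually_le_const hδ).and (Filter.eventually_ge_atTop 1)))).exists
  refine le_trans ?_ hN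
  have hset : MeasurableSet {y : Fin N → USphere d | |(√N)⁻¹ * ∑ j, Y 1 k (y j)| ≤ δ} :=
    measurableSet_le (by fun_prop) measurable_const
  rw [← (hX N hNI).hasLaw.measure_eq hset]
  refine measure_mono fun ω hω => ?_
  have hN0 : (0 : ℝ) < N := by exact_mod_cast hN1
  have h1 := hω N hNI hN1
  set r : ℝ := c / (N : ℝ) ^ (s / (d : ℝ)) with hr
  have hr0 : 0 ≤ r := by positivity
  have h2 := (ofReal_mul_sq_le_worstCaseError_sq hd hs ha hY (fun j => X N j ω) 1 k).trans
    (pow_le_pow_left' h1 2)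
  rw [← ENNReal.ofReal_pow hr0, ENNReal.ofReal_le_ofReal_iff (by positivity),
    quadratureError_apply, hf, sub_zero] at h2
  set S : ℝ := ∑ j, Y 1 k (X N j ω)
  have h3 : √(a 1) * |1 / (N : ℝ) * S| ≤ r := by
    refine abs_le_of_sq_le_sq' ?_ hr0 |>.2
    rwa [mul_pow, Real.sq_sqrt (ha.1 1).le, sq_abs]
  change |(√N)⁻¹ * S| ≤ δ
  refine le_trans ?_ hsmall
  have hsq : (√(N : ℝ))⁻¹ = √N * (1 / N) := by
    have := Real.mul_self_sqrt hN0.le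
    have h0 : √(N : ℝ) ≠ 0 := (Real.sqrt_pos.2 hN0).ne'
    field_simp
    nlinarith
  have hpow : √(N : ℝ) * r = c * (N : ℝ) ^ (-(s / d - 1 / 2)) := by
    rw [hr, Real.sqrt_eq_rpow, neg_sub, Real.rpow_sub hN0]
    ring
  rw [hsq, mul_assoc, abs_mul, abs_of_nonneg (Real.sqrt_nonneg _),
    div_mul_eq_mul_div c,
    le_div_iff₀ ha1, ← hpow, mul_assoc]
  refine mul_le_mul_of_nonneg_left ?_ (Real.sqrt_nonneg _)
  rwa [mul_comm]

theorem theorem1p5 (d : ℕ) (hd : 2 ≤ d) (s : ℝ) (hs : (d : ℝ) / 2 < s)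
    (a : ℕ → ℝ) (ha : IsSobolevWeight d s a) :
    -- exact root-mean-square worst-case error of random points
    (∃ b : ℝ, 0 < b ∧
      ∀ Y : (ℓ : ℕ) → Fin (harmonicDim d ℓ) → C(USphere d, ℝ), IsHarmonicBasis d Y →
      ∀ (Ω : Type u) [MeasurableSpace Ω] (P : Measure Ω) [IsProbabilityMeasure P]
        (N : ℕ) (x : Fin N → Ω → USphere d), 1 ≤ N → IsIIDUniform P x →
        AEMeasurable (fun ω => worstCaseError s a Y (fun j => x j ω)) P ∧
        (∫⁻ ω, worstCaseError s a Y (fun j => x j ω) ^ 2 ∂P) ^ (1 / 2 : ℝ) =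
          ENNReal.ofReal (b / (N : ℝ) ^ (1 / 2 : ℝ))) ∧
    -- random points almost surely do not form a sequence of QMC designs
    (∀ Y : (ℓ : ℕ) → Fin (harmonicDim d ℓ) → C(USphere d, ℝ), IsHarmonicBasis d Y →
      ∀ (Ω : Type u) [MeasurableSpace Ω] (P : Measure Ω) [IsProbabilityMeasure P]
        (I : Set ℕ) (X : (N : ℕ) → Fin N → Ω → USphere d), I.Infinite →
        (∀ N ∈ I, IsIIDUniform P (X N)) →
        ∀ᵐ ω ∂P, ¬ IsQMCDesignSequence s a Y I (fun N j => X N j ω)) := by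
  refine ⟨?_, ?_⟩
  · have hsum := (summable_nat_add_iff 1).2 (ha.summable_mul_harmonicDim hd hs)
    have hnn : ∀ ℓ, 0 ≤ a (ℓ + 1) * harmonicDim d (ℓ + 1) := fun ℓ =>
      mul_nonneg (ha.1 _).le (Nat.cast_nonneg _)
    have hB : 0 < ∑' ℓ, a (ℓ + 1) * (harmonicDim d (ℓ + 1) : ℝ) :=
      hsum.tsum_pos hnn 0 (mul_pos (ha.1 1) (Nat.cast_pos.2 (harmonicDim_one_pos hd)))
    refine ⟨√(∑' ℓ, a (ℓ + 1) * (harmonicDim d (ℓ + 1) : ℝ)), Real.sqrt_pos.2 hB, ?_⟩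
    intro Y hY Ω _ P _ N x hN hx
    have hm := measurable_worstCaseError hd hs ha hY N
    refine ⟨hm.comp_aemeasurable hx.hasLaw.aemeasurable, ?_⟩
    have hlaw : ∫⁻ ω, worstCaseError s a Y (fun j => x j ω) ^ 2 ∂P =
        ∫⁻ y, worstCaseError s a Y y ^ 2 ∂(Measure.pi fun _ : Fin N => sphereMeasure d) := by
      rw [← hx.hasLaw.map_eq]
      exact (lintegral_map' (hm.pow_const 2).aemeasurable hx.hasLaw.aemeasurable).symm
    rw [hlaw, lintegral_worstCaseError_sq hd hs ha hY hN,
      ENNReal.ofReal_rpow_of_nonneg (by positivity) (by positivity),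
      Real.div_rpow hB.le (Nat.cast_nonneg _), Real.sqrt_eq_rpow]
  · intro Y hY Ω _ P _ I X hI hX
    have hall : ∀ᵐ ω ∂P, ∀ n : ℕ, ¬ ∀ N ∈ I, 1 ≤ N →
        worstCaseError s a Y (fun j => X N j ω) ≤
          ENNReal.ofReal ((n : ℝ) / (N : ℝ) ^ (s / (d : ℝ))) := by
      refine ae_all_iff.2 fun n => ?_
      rw [ae_iff]
      simp only [not_not]
      exact measure_forall_worstCaseError_le_eq_zero hd hs ha hY hI hX (Nat.cast_nonneg n)
    filter_upwards [hall] with ω hω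
    rintro ⟨-, c, -, hc⟩
    obtain ⟨n, hn⟩ := exists_nat_ge c
    refine hω n fun N hN hN1 => (hc N hN hN1).trans (ENNReal.ofReal_le_ofReal ?_)
    gcongr
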